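/- Conventions. Fix $n\in\mathbb N$. Functions are real- or complex-valued. A \emph{weight sequence} is a sequence $M=(M_k)_{k\ge0}$ of positive reals with $M_0=1\le M_1\le\mu_2\le\mu_3\le\cdots$, where $\mu_k:=M_k/M_{k-1}$; put $m_k:=M_k^{1/k}$ for $k\ge1$ and $m_0:=1$ (for $M'$ write $m'_k$). A \emph{base sequence} is a strictly increasing sequence of integers $0=k_0<k_1<k_2<\cdots$; it is \emph{special} if $k_{j+1}/k_j$, $j\ge1$, is bounded. Let $\mathfrak M$ be a family of weight sequences that is totally ordered: for $M,M'\in\mathfrak M$ either $M_j\le M'_j$ for all $j$, or $M'_j\le M_j$ for all $j$. The placeholder $[\cdot]$ stands for either $\{\cdot\}$ (Roumieu case) or $(\cdot)$ (Beurling case). Classes. Let $1\le p\le\infty$ and let $U\subseteq\mathbb R^n$ be open. For $\Omega\subseteq\mathbb R^n$ open and $K\subseteq\mathbb N$ consider the estimate $$(*)\qquad \|\partial^\alpha f\|_{L^p(\Omega)}\le C(\rho\, m_{|\alpha|})^{|\alpha|}\quad\text{for all }\alpha\in\mathbb N^n\text{ with }|\alpha|\in K .$$ - $\mathcal E^{\{\mathfrak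 M\}}_{L^p}(U)$ (resp. $\mathcal E^{(\mathfrak M)}_{L^p}(U)$) is the set of $f\in C^\infty(U)$ such that for every open relatively compact $\Omega\Subset U$ there exist $M\in\mathfrak M$, $\rho,C>0$ (resp. for every $M\in\mathfrak M$ and $\rho>0$ there exists $C>0$) with $(*)$ for $K=\mathbb N$. - $\mathcal B^{\{\mathfrak M\}}_{L^p}(\mathbb R^n)$ (resp. $\mathcal B^{(\mathfrak M)}_{L^p}(\mathbb R^n)$) is the set of $f\in C^\infty(\mathbb R^n)$ such that there exist $M\in\mathfrak M$, $\rho,C>0$ (resp. for every $M\in\mathfrak M$ and $\rho>0$ there exists $C>0$) with $(*)$ for $\Omega=\mathbb R^n$, $K=\mathbb N$. - $\mathcal D^{[\mathfrak M]}(\mathbb R^n)$ is the set of compactly supported functions in $\mathcal B^{[\mathfrak M]}_{L^\infty}(\mathbb R^n)$. - $\mathcal E^{[\mathfrak M]}_{L^p,(k_j)}(U)$, $\mathcal B^{[\mathfrak M]}_{L^p,(k_j)}(\mathbb R^n)$, $\mathcal D^{[\mathfrak M]}_{(k_j)}(\mathbb R^n)$ are defined in the same way with $K=\{k_j:j\ge0\}$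 instead of $K=\mathbb N$. - $\mathcal S^{\{\mathfrak M\}}(\mathbb R^n)$ (resp. $\mathcal S^{(\mathfrak M)}(\mathbb R^n)$) is the set of $f\in C^\infty(\mathbb R^n)$ such that there exist $M\in\mathfrak M$, $\rho,\sigma>0$ (resp. for all $M\in\mathfrak M$, $\rho,\sigma>0$) with $$\sup_{\alpha,\beta\in\mathbb N^n}\sup_{x\in\mathbb R^n}\frac{|x^\alpha\partial^\beta f(x)|}{(\rho\, m_{|\alpha|})^{|\alpha|}(\sigma\, m_{|\beta|})^{|\beta|}}<\infty .$$ - For base sequences $(k_j),(\ell_j)$, $\mathcal S^{\{\mathfrak M\}}_{(k_j),(\ell_j)}(\mathbb R^n)$ (resp. $\mathcal S^{(\mathfrak M)}_{(k_j),(\ell_j)}(\mathbb R^n)$) is the set of $f\in C^\infty(\mathbb R^n)$ such that there exist $M\in\mathfrak M$ and $\rho,\sigma,C>0$ (resp. for all $M\in\mathfrak M$, $\rho,\sigma>0$ there exists $C>0$) with $$\max_{|\alpha|=k_j}\sup_x|x^\alpha f(x)|\le C(\rho\, m_{k_j})^{k_j}\quad\text{and}\quad \max_{|\beta|=\ell_j}\sup_x|\partial^\beta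 f(x)|\le C(\sigma\, m_{\ell_j})^{\ell_j}\quad\text{for all } j\ge0 .$$ Conditions. We say that $\mathfrak M$ satisfies $(\mathrm{R}_{(k_j)})$ if for every $M\in\mathfrak M$ there is $M'\in\mathfrak M$ such that $m_{k_{j+1}}/m'_{k_j}$ is bounded in $j$, and that it satisfies $(\mathrm{B}_{(k_j)})$ if for every $M\in\mathfrak M$ there is $M'\in\mathfrak M$ such that $m'_{k_{j+1}}/m_{k_j}$ is bounded in $j$. We say that $\mathfrak M$ has [moderate growth] if for every $M\in\mathfrak M$ there are $M'\in\mathfrak M$ and $C>0$ such that for all $j,k\ge0$: $M_{j+k}\le C^{j+k}M'_jM'_k$ in the Roumieu case, and $M'_{j+k}\le C^{j+k}M_jM_k$ in the Beurling case. Theorem. Let $1\le p\le\infty$, let $(k_j),(\ell_j)$ be base sequences, and let $\mathfrak M$ be a totally ordered family of weight sequences satisfying $(\mathrm R_{(k_j)})$ in the Roumieu case and $(\mathrm B_{(k_j)})$ in the Beurling case. Then, in each of the two cases: (a) $\mathcal B^{[\mathfrak M]}_{L^p,(k_j)}(\mathbb R^n)=\mathcal B^{[\mathfrak M]}_{L^p}(\mathbb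 R^n)$. (b) $\mathcal D^{[\mathfrak M]}_{(k_j)}(\mathbb R^n)=\mathcal D^{[\mathfrak M]}(\mathbb R^n)$. Assume additionally that, for all $M\in\mathfrak M$, $j/m_j$ is bounded in the Roumieu case, and tends to $0$ in the Beurling case. Then: (c) $\mathcal E^{[\mathfrak M]}_{L^p,(k_j)}(U)=\mathcal E^{[\mathfrak M]}_{L^p}(U)$ for all open $U\subseteq\mathbb R^n$, provided that $(k_j)$ is a special base sequence. (d) $\mathcal S^{[\mathfrak M]}_{(k_j),(\ell_j)}(\mathbb R^n)=\mathcal S^{[\mathfrak M]}(\mathbb R^n)$, provided that $\mathfrak M$ has [moderate growth] and that $\mathfrak M$ satisfies also $(\mathrm R_{(\ell_j)})$ in the Roumieu case and $(\mathrm B_{(\ell_j)})$ in the Beurling case. -/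

import Mathlib

open MeasureTheory Filter Topology
open scoped ENNReal ContDiff

namespace Lacunary

noncomputable section

/-! ### Weight sequences, base sequences, families of weight sequences -/

/-- `M` is a weight sequence: it is positive and `M₀ = 1 ≤ M₁ ≤ μ₂ ≤ μ₃ ≤ ⋯`, where
`μₖ = Mₖ / Mₖ₋₁` (so that `μ₁ = M₁`). -/
structure IsWeightSequence (M : ℕ → ℝ) : Prop where
  pos : ∀ k, 0 < M k
  zero : M 0 = 1
  one_le : 1 ≤ M 1
  quot_mono : ∀ k, M (k + 1) / M k ≤ M (k + 2) / M (k + 1)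

/-- `root M k` is `mₖ = Mₖ ^ (1 / k)`. For a weight sequence `root M 0 = 1`. -/
def root (M : ℕ → ℝ) (k : ℕ) : ℝ := M k ^ (1 / (k : ℝ))

/-- `0 = k₀ < k₁ < k₂ < ⋯`. -/
structure IsBaseSequence (k : ℕ → ℕ) : Prop where
  zero : k 0 = 0
  strictMono : StrictMono k

/-- A base sequence for which `kⱼ₊₁ / kⱼ`, `j ≥ 1`, is bounded. -/
structure IsSpecialBaseSequence (k : ℕ → ℕ) : Prop extends IsBaseSequence k where
  bounded : ∃ A : ℝ, ∀ j, 1 ≤ j → (k (j + 1) : ℝ) / (k j : ℝ) ≤ A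

/-- A totally ordered family of weight sequences (for the pointwise order). -/
structure IsWeightFamily (𝔐 : Set (ℕ → ℝ)) : Prop where
  weight : ∀ M ∈ 𝔐, IsWeightSequence M
  total : ∀ M ∈ 𝔐, ∀ M' ∈ 𝔐, (∀ j, M j ≤ M' j) ∨ (∀ j, M' j ≤ M j)

/-- For all `M ∈ 𝔐` there is `M' ∈ 𝔐` such that `m_{kⱼ₊₁} / m'_{kⱼ}` is bounded. -/
def RoumieuMixed (𝔐 : Set (ℕ → ℝ)) (k : ℕ → ℕ) : Prop :=
  ∀ M ∈ 𝔐, ∃ M' ∈ 𝔐, ∃ A : ℝ, ∀ j, root M (k (j + 1)) / root M' (k j) ≤ A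

/-- For all `M ∈ 𝔐` there is `M' ∈ 𝔐` such that `m'_{kⱼ₊₁} / m_{kⱼ}` is bounded. -/
def BeurlingMixed (𝔐 : Set (ℕ → ℝ)) (k : ℕ → ℕ) : Prop :=
  ∀ M ∈ 𝔐, ∃ M' ∈ 𝔐, ∃ A : ℝ, ∀ j, root M' (k (j + 1)) / root M (k j) ≤ A

/-- Moderate growth of the family, Roumieu case. -/
def RoumieuModerateGrowth (𝔐 : Set (ℕ → ℝ)) : Prop :=
  ∀ M ∈ 𝔐, ∃ M' ∈ 𝔐, ∃ C : ℝ, 0 < C ∧ ∀ j k : ℕ, M (j + k) ≤ C ^ (j + k) * M' j * M' k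

/-- Moderate growth of the family, Beurling case. -/
def BeurlingModerateGrowth (𝔐 : Set (ℕ → ℝ)) : Prop :=
  ∀ M ∈ 𝔐, ∃ M' ∈ 𝔐, ∃ C : ℝ, 0 < C ∧ ∀ j k : ℕ, M' (j + k) ≤ C ^ (j + k) * M j * M k

/-! ### Multi-indices -/

/-- The order `|α|` of a multi-index. -/
def order {n : ℕ} (α : Fin n → ℕ) : ℕ := ∑ i, α i

/-- The monomial `x ^ α`. -/
def monom {n : ℕ} (α : Fin n → ℕ) (x : EuclideanSpace ℝ (Fin n)) : ℝ := ∏ i, x i ^ α i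

variable {n : ℕ} {𝕜 : Type*} [RCLike 𝕜]

/-- The partial derivative in the direction of the `i`-th standard unit vector. -/
def partialDeriv (i : Fin n) (f : EuclideanSpace ℝ (Fin n) → 𝕜) :
    EuclideanSpace ℝ (Fin n) → 𝕜 :=
  fun x => fderiv ℝ f x (EuclideanSpace.single i 1)

/-- `∂ ^ α f`, the partial derivative `∂₁ ^ α₁ ⋯ ∂ₙ ^ αₙ f`. -/
def multiDeriv (α : Fin n → ℕ) (f : EuclideanSpace ℝ (Fin n) → 𝕜) :
    EuclideanSpace ℝ (Fin n) → 𝕜 :=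
  (List.finRange n).foldr (fun i g => (partialDeriv i)^[α i] g) f

/-! ### The estimates -/

/-- `‖∂ ^ α f‖_{L^p(Ω)} ≤ C (ρ m_{|α|}) ^ |α|` for all multi-indices `α` whose order lies
in the set `K`. -/
def DerivBound (p : ℝ≥0∞) (Ω : Set (EuclideanSpace ℝ (Fin n))) (K : Set ℕ) (M : ℕ → ℝ)
    (ρ C : ℝ) (f : EuclideanSpace ℝ (Fin n) → 𝕜) : Prop :=
  ∀ α : Fin n → ℕ, order α ∈ K →
    eLpNorm (multiDeriv α f) p (volume.restrict Ω) ≤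
      ENNReal.ofReal (C * (ρ * root M (order α)) ^ order α)

/-- The estimates defining the lacunary Gelfand-Shilov classes. -/
def LacunaryGSBound (k l : ℕ → ℕ) (M : ℕ → ℝ) (ρ σ C : ℝ)
    (f : EuclideanSpace ℝ (Fin n) → 𝕜) : Prop :=
  (∀ j, ∀ α : Fin n → ℕ, order α = k j → ∀ x,
      |monom α x| * ‖f x‖ ≤ C * (ρ * root M (k j)) ^ k j) ∧
  (∀ j, ∀ β : Fin n → ℕ, order β = l j → ∀ x,
      ‖multiDeriv β f x‖ ≤ C * (σ * root M (l j)) ^ l j)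

/-- The estimates defining the (full) Gelfand-Shilov classes. -/
def GSBound (M : ℕ → ℝ) (ρ σ C : ℝ) (f : EuclideanSpace ℝ (Fin n) → 𝕜) : Prop :=
  ∀ (α β : Fin n → ℕ) (x : EuclideanSpace ℝ (Fin n)),
    |monom α x| * ‖multiDeriv β f x‖ ≤
      C * ((ρ * root M (order α)) ^ order α * (σ * root M (order β)) ^ order β)

/-! ### The classes

The parameter `K` is the set of those orders of differentiation for which the estimates are
required: `K = Set.univ` gives the full class and `K = Set.range k` the class that is lacunary
along the base sequence `k`. -/

variable (n 𝕜)

/-- `ℬ^{𝔐}_{L^p}(ℝⁿ)`, Roumieu case. -/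
def BRoumieu (𝔐 : Set (ℕ → ℝ)) (p : ℝ≥0∞) (K : Set ℕ) :
    Set (EuclideanSpace ℝ (Fin n) → 𝕜) :=
  {f | ContDiff ℝ ∞ f ∧ ∃ M ∈ 𝔐, ∃ ρ : ℝ, 0 < ρ ∧ ∃ C : ℝ, 0 < C ∧
    DerivBound p Set.univ K M ρ C f}

/-- `ℬ^(𝔐)_{L^p}(ℝⁿ)`, Beurling case. -/
def BBeurling (𝔐 : Set (ℕ → ℝ)) (p : ℝ≥0∞) (K : Set ℕ) :
    Set (EuclideanSpace ℝ (Fin n) → 𝕜) :=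
  {f | ContDiff ℝ ∞ f ∧ ∀ M ∈ 𝔐, ∀ ρ : ℝ, 0 < ρ → ∃ C : ℝ, 0 < C ∧
    DerivBound p Set.univ K M ρ C f}

/-- `𝒟^{𝔐}(ℝⁿ)`, Roumieu case. -/
def DRoumieu (𝔐 : Set (ℕ → ℝ)) (K : Set ℕ) : Set (EuclideanSpace ℝ (Fin n) → 𝕜) :=
  {f | f ∈ BRoumieu n 𝕜 𝔐 ∞ K ∧ HasCompactSupport f}

/-- `𝒟^(𝔐)(ℝⁿ)`, Beurling case. -/
def DBeurling (𝔐 : Set (ℕ → ℝ)) (K : Set ℕ) : Set (EuclideanSpace ℝ (Fin n) → 𝕜) :=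
  {f | f ∈ BBeurling n 𝕜 𝔐 ∞ K ∧ HasCompactSupport f}

variable {n}

/-- `Ω` is an open relatively compact subset of `U`. -/
def RelCompactIn (Ω U : Set (EuclideanSpace ℝ (Fin n))) : Prop :=
  IsOpen Ω ∧ IsCompact (closure Ω) ∧ closure Ω ⊆ U

/-- `ℰ^{𝔐}_{L^p}(U)`, Roumieu case. Elements are functions that are smooth on the open set `U`;
their values outside of `U` play no role. -/
def ERoumieu (𝔐 : Set (ℕ → ℝ)) (p : ℝ≥0∞) (U : Set (EuclideanSpace ℝ (Fin n)))
    (K : Set ℕ) : Set (EuclideanSpace ℝ (Fin n) → 𝕜) :=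
  {f | ContDiffOn ℝ ∞ f U ∧ ∀ Ω, RelCompactIn Ω U →
    ∃ M ∈ 𝔐, ∃ ρ : ℝ, 0 < ρ ∧ ∃ C : ℝ, 0 < C ∧ DerivBound p Ω K M ρ C f}

/-- `ℰ^(𝔐)_{L^p}(U)`, Beurling case. -/
def EBeurling (𝔐 : Set (ℕ → ℝ)) (p : ℝ≥0∞) (U : Set (EuclideanSpace ℝ (Fin n)))
    (K : Set ℕ) : Set (EuclideanSpace ℝ (Fin n) → 𝕜) :=
  {f | ContDiffOn ℝ ∞ f U ∧ ∀ Ω, RelCompactIn Ω U →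
    ∀ M ∈ 𝔐, ∀ ρ : ℝ, 0 < ρ → ∃ C : ℝ, 0 < C ∧ DerivBound p Ω K M ρ C f}

variable (n)

/-- The Gelfand-Shilov class `𝒮^{𝔐}(ℝⁿ)`, Roumieu case. -/
def SRoumieu (𝔐 : Set (ℕ → ℝ)) : Set (EuclideanSpace ℝ (Fin n) → 𝕜) :=
  {f | ContDiff ℝ ∞ f ∧ ∃ M ∈ 𝔐, ∃ ρ : ℝ, 0 < ρ ∧ ∃ σ : ℝ, 0 < σ ∧ ∃ C : ℝ, 0 < C ∧
    GSBound M ρ σ C f}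

/-- The Gelfand-Shilov class `𝒮^(𝔐)(ℝⁿ)`, Beurling case. -/
def SBeurling (𝔐 : Set (ℕ → ℝ)) : Set (EuclideanSpace ℝ (Fin n) → 𝕜) :=
  {f | ContDiff ℝ ∞ f ∧ ∀ M ∈ 𝔐, ∀ ρ : ℝ, 0 < ρ → ∀ σ : ℝ, 0 < σ → ∃ C : ℝ, 0 < C ∧
    GSBound M ρ σ C f}

/-- The lacunary Gelfand-Shilov class `𝒮^{𝔐}_{(kⱼ),(lⱼ)}(ℝⁿ)`, Roumieu case. -/
def SRoumieuLac (𝔐 : Set (ℕ → ℝ)) (k l : ℕ → ℕ) :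
    Set (EuclideanSpace ℝ (Fin n) → 𝕜) :=
  {f | ContDiff ℝ ∞ f ∧ ∃ M ∈ 𝔐, ∃ ρ : ℝ, 0 < ρ ∧ ∃ σ : ℝ, 0 < σ ∧ ∃ C : ℝ, 0 < C ∧
    LacunaryGSBound k l M ρ σ C f}

/-- The lacunary Gelfand-Shilov class `𝒮^(𝔐)_{(kⱼ),(lⱼ)}(ℝⁿ)`, Beurling case. -/
def SBeurlingLac (𝔐 : Set (ℕ → ℝ)) (k l : ℕ → ℕ) :
    Set (EuclideanSpace ℝ (Fin n) → 𝕜) :=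
  {f | ContDiff ℝ ∞ f ∧ ∀ M ∈ 𝔐, ∀ ρ : ℝ, 0 < ρ → ∀ σ : ℝ, 0 < σ → ∃ C : ℝ, 0 < C ∧
    LacunaryGSBound k l M ρ σ C f}

end

end Lacunary

open Lacunary

/-! The heart is a Landau-Kolmogorov inequality whose constants do not deteriorate with the order of
the top derivative: if `‖g‖ ≤ A` and `‖∂ᵢ^l g‖ ≤ A T^l`, then `‖∂ᵢ^s g‖ ≤ 2 A (12 T)^s` for all `s <
l`, on a domain smaller by `l / (6 T)` in the direction `i` (`eLpNorm_iterate_partialDeriv_le`).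

It rests on a differentiation formula. Writing `D = arsinh (sinh D)` with `sinh D` a central
difference gives `D^s = ∑ aₖ (sinh D)^k`, where `aₖ` are the coefficients of `arsinh^s`. As `(sinh
D)^k` annihilates polynomials of degree below `k`, the part `k < l` is exact in degree below `l`.
The difference `(sinh D)^k` has weights of total mass `1`, and the coefficients of `arsinh` are
absolutely summable with sum at most `2`, so the total mass is at most `2^s` for every `l`
(`exists_differentiation_weights`). Applied to `g` minus its Taylor remainder, with step `1 / (6
T)`, this gives the inequality; treating one coordinate after another gives mixed derivatives
(`eLpNorm_multiDeriv_add_le`).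

For `kⱼ ≤ |α| < kⱼ₊₁`, interpolation with `T = ρ m_{kⱼ₊₁}` between the orders `kⱼ` and `kⱼ₊₁` yields
`(12 T)^|α|` up to a constant. The mixed condition bounds `T` by a multiple of `m'_{kⱼ}`, and
`m'_{kⱼ} ≤ m'_{|α|}` (`DerivBound.of_lacunary`). On all of space there is no boundary; locally the
loss of domain is at most a multiple of `kⱼ₊₁ / m_{kⱼ₊₁}`, which the hypothesis on `j / mⱼ`
controls.

For Gelfand-Shilov classes, both families of bounds are first filled in separately. Interpolation on
a unit ball between `f` and its derivatives of order `2|β|` then acts like `|x|^i |∂^β f| ≲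
(|x|^{2i} |f|)^{1/2} (sup |∂^{2|β|} f|)^{1/2}`, and moderate growth splits `M_{2i}` and `M_{2|β|}`
(`norm_pow_mul_multiDeriv_le`). -/

namespace Lacunary

/-! ### Numerical differentiation with uniformly bounded weights -/

section Weights

open PowerSeries Finset

/-- The Taylor coefficients of `(1 + z ^ 2) ^ (-1 / 2)`. -/
noncomputable def invSqrtCoeff : ℕ → ℝ
  | 0 => 1
  | 1 => 0
  | m + 2 => -((m + 1) / (m + 2)) * invSqrtCoeff m

/-- The power series of `(1 + z ^ 2) ^ (-1 / 2)`. -/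
noncomputable def invSqrtSeries : ℝ⟦X⟧ := PowerSeries.mk invSqrtCoeff

/-- The power series of the inverse hyperbolic sine. -/
noncomputable def arsinhSeries : ℝ⟦X⟧ :=
  PowerSeries.mk fun m => if m = 0 then 0 else invSqrtCoeff (m - 1) / m

/-- The power series of the hyperbolic sine. -/
noncomputable def sinhSeries : ℝ⟦X⟧ :=
  C (1 / 2 : ℝ) * (rescale 1 (PowerSeries.exp ℝ) - rescale (-1) (PowerSeries.exp ℝ))

/-- The power series of the hyperbolic cosine. -/
noncomputable def coshSeries : ℝ⟦X⟧ :=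
  C (1 / 2 : ℝ) * (rescale 1 (PowerSeries.exp ℝ) + rescale (-1) (PowerSeries.exp ℝ))

/-! ### Formal power series: `arsinh` inverts `sinh` -/

lemma derivative_rescale_exp (a : ℝ) :
    d⁄dX ℝ (rescale a (PowerSeries.exp ℝ)) = C a * rescale a (PowerSeries.exp ℝ) := by
  ext m
  simp only [coeff_derivative, coeff_rescale, coeff_exp, coeff_C_mul, Nat.factorial_succ]
  have : ((m : ℝ) + 1) ≠ 0 := by positivity
  have : ((m.factorial : ℕ) : ℝ) ≠ 0 := by positivity
  simp
  field_simp
  ring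

lemma derivative_sinhSeries : d⁄dX ℝ sinhSeries = coshSeries := by
  simp only [sinhSeries, coshSeries, Derivation.leibniz, map_sub, derivative_rescale_exp,
    derivative_C, smul_eq_mul]
  simp

lemma derivative_coshSeries : d⁄dX ℝ coshSeries = sinhSeries := by
  simp only [sinhSeries, coshSeries, Derivation.leibniz, map_add, derivative_rescale_exp,
    derivative_C, smul_eq_mul]
  simp [sub_eq_add_neg]

lemma coshSeries_sq : coshSeries ^ 2 = 1 + sinhSeries ^ 2 := by
  have h : rescale (1 : ℝ) (PowerSeries.exp ℝ) * rescale (-1) (PowerSeries.exp ℝ) = 1 := by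
    rw [exp_mul_exp_eq_exp_add]; simp
  have h2 : (C (1 / 2 : ℝ)) * 2 = 1 := by
    rw [show (2 : ℝ⟦X⟧) = C (2 : ℝ) from (map_ofNat (C (R := ℝ)) 2).symm, ← map_mul]; norm_num
  rw [coshSeries, sinhSeries]
  linear_combination (C (1 / 2 : ℝ)) ^ 2 * 4 * h + (C (1/2 : ℝ) * 2 + 1) * h2

lemma constantCoeff_sinhSeries : constantCoeff sinhSeries = 0 := by
  simp only [sinhSeries, ← coeff_zero_eq_constantCoeff, coeff_C_mul, map_sub, coeff_rescale, coeff_exp]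
  norm_num

lemma constantCoeff_coshSeries : constantCoeff coshSeries = 1 := by
  simp only [coshSeries, ← coeff_zero_eq_constantCoeff, coeff_C_mul, map_add, coeff_rescale, coeff_exp]
  norm_num

lemma hasSubst_sinhSeries : HasSubst sinhSeries :=
  HasSubst.of_constantCoeff_zero' constantCoeff_sinhSeries

lemma invSqrtSeries_ode :
    (1 + X ^ 2) * d⁄dX ℝ invSqrtSeries + X * invSqrtSeries = 0 := by
  ext m
  rcases m with _ | _ | m
  · have h : coeff 0 (d⁄dX ℝ invSqrtSeries) = 0 := by
      simp only [coeff_derivative, invSqrtSeries, coeff_mk, invSqrtCoeff, zero_mul]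
    rw [coeff_zero_eq_constantCoeff_apply] at h ⊢
    simp [h]
  · simp [add_mul, invSqrtSeries, coeff_derivative, invSqrtCoeff, coeff_X_pow_mul', coeff_succ_X_mul]
    norm_num
  · simp [add_mul, invSqrtSeries, coeff_derivative, invSqrtCoeff, coeff_X_pow_mul', coeff_succ_X_mul]
    field_simp
    ring

lemma derivative_arsinhSeries : d⁄dX ℝ arsinhSeries = invSqrtSeries := by
  ext m
  simp [arsinhSeries, invSqrtSeries, coeff_derivative]
  field_simp

/-- Without a constant term, `g ^ k` is divisible by `X ^ k`, so powers `k ≥ l` cannot contribute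
below degree `l`. This is why a truncated series of differences is exact on polynomials of low
degree. -/
lemma coeff_subst_of_lt {g : ℝ⟦X⟧} (hg : constantCoeff g = 0) (F : ℝ⟦X⟧) {m l : ℕ} (hm : m < l) :
    coeff m (F.subst g) = ∑ k ∈ range l, coeff k F * coeff m (g ^ k) := by
  have hs : HasSubst g := HasSubst.of_constantCoeff_zero' hg
  rw [coeff_subst' hs, finsum_eq_sum_of_support_subset (s := range l)]
  · simp
  · intro k hk
    by_contra hkl
    apply hk
    have hd : (X : ℝ⟦X⟧) ^ k ∣ g ^ k := pow_dvd_pow_of_dvd (X_dvd_iff.2 hg) k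
    have : coeff m (g ^ k) = 0 := X_pow_dvd_iff.1 hd m (by simp at hkl; omega)
    simp [this]

lemma constantCoeff_subst_of_zero {g : ℝ⟦X⟧} (hg : constantCoeff g = 0) (F : ℝ⟦X⟧) :
    constantCoeff (F.subst g : ℝ⟦X⟧) = constantCoeff F := by
  have h := coeff_subst_of_lt hg F (m := 0) (l := 1) one_pos
  simpa using h

/-- The derivative of the product vanishes, by the differential equation of `(1 + z ^ 2) ^ (-1 / 2)`
evaluated at `sinh` together with `cosh ^ 2 = 1 + sinh ^ 2`; the constant terms agree. -/
lemma subst_invSqrtSeries_mul : invSqrtSeries.subst sinhSeries * coshSeries = 1 := by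
  have hs := hasSubst_sinhSeries
  apply derivative.ext
  · have h := congrArg (substAlgHom (R := ℝ) hs) invSqrtSeries_ode
    simp only [map_add, map_mul, map_one, map_pow, map_zero, substAlgHom_X] at h
    rw [Derivation.leibniz, derivative_subst hs, derivative_sinhSeries, derivative_coshSeries,
      derivative_one]
    simp only [smul_eq_mul]
    rw [← coe_substAlgHom (R := ℝ) hs]
    linear_combination h + (substAlgHom hs (d⁄dX ℝ invSqrtSeries)) * coshSeries_sq
  · rw [map_mul, constantCoeff_coshSeries, mul_one,
      constantCoeff_subst_of_zero constantCoeff_sinhSeries, map_one,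
      ← coeff_zero_eq_constantCoeff_apply]
    simp only [invSqrtSeries, coeff_mk, invSqrtCoeff]

lemma constantCoeff_arsinhSeries : constantCoeff arsinhSeries = 0 := by
  rw [← coeff_zero_eq_constantCoeff_apply]
  simp only [arsinhSeries, coeff_mk, if_true]

lemma subst_arsinhSeries : arsinhSeries.subst sinhSeries = (X : ℝ⟦X⟧) := by
  have hs := hasSubst_sinhSeries
  apply derivative.ext
  · rw [derivative_subst hs, derivative_arsinhSeries, derivative_sinhSeries,
      subst_invSqrtSeries_mul, derivative_X]
  · rw [constantCoeff_subst_of_zero constantCoeff_sinhSeries, constantCoeff_arsinhSeries,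
      constantCoeff_X]

/-! ### Truncated coefficient sums and the mass of the weights -/

lemma sum_abs_coeff_mul_le (F G : ℝ⟦X⟧) (l : ℕ) :
    ∑ k ∈ range l, |coeff k (F * G)| ≤
      (∑ k ∈ range l, |coeff k F|) * ∑ k ∈ range l, |coeff k G| := by
  calc ∑ k ∈ range l, |coeff k (F * G)|
      ≤ ∑ k ∈ range l, ∑ q ∈ antidiagonal k, |coeff q.1 F| * |coeff q.2 G| := by
        refine sum_le_sum fun k _ => ?_
        rw [coeff_mul]
        refine (abs_sum_le_sum_abs _ _).trans_eq ?_
        simp [abs_mul]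
    _ = ∑ q ∈ (range l).sigma fun k => antidiagonal k, |coeff q.2.1 F| * |coeff q.2.2 G| := by
        rw [sum_sigma]
    _ = ∑ q ∈ ((range l).sigma fun k => antidiagonal k).image (fun q => q.2),
          |coeff q.1 F| * |coeff q.2 G| := by
        rw [sum_image]
        rintro ⟨a, q⟩ ha ⟨b, q'⟩ hb h
        simp at ha hb h
        subst h
        obtain rfl : a = b := by rw [← ha.2, ← hb.2]
        rfl
    _ ≤ ∑ q ∈ range l ×ˢ range l, |coeff q.1 F| * |coeff q.2 G| := by
        refine sum_le_sum_of_subset_of_nonneg ?_ fun _ _ _ => by positivity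
        rintro ⟨a, b⟩ h
        simp at h ⊢
        omega
    _ = _ := by rw [sum_product, sum_mul_sum]

lemma sum_abs_coeff_pow_le (F : ℝ⟦X⟧) (l s : ℕ) :
    ∑ k ∈ range l, |coeff k (F ^ s)| ≤ max 1 (∑ k ∈ range l, |coeff k F|) ^ s := by
  induction s with
  | zero =>
    simp only [pow_zero, coeff_one]
    calc ∑ k ∈ range l, |if k = 0 then (1 : ℝ) else 0|
        = ∑ k ∈ range l, if k = 0 then (1 : ℝ) else 0 := by
          refine sum_congr rfl fun k _ => ?_
          split_ifs <;> simp
      _ ≤ 1 := by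
          rw [sum_ite_eq']
          split_ifs <;> norm_num
  | succ s ih =>
    rw [pow_succ, pow_succ]
    refine (sum_abs_coeff_mul_le _ _ _).trans ?_
    have h0 : 0 ≤ ∑ k ∈ range l, |coeff k F| := sum_nonneg fun _ _ => abs_nonneg _
    gcongr
    exact le_max_right _ _

/-- The recursion gives `|cₘ| - |cₘ₊₂| = |cₘ| / (m + 2)`, and `m + 2 ≤ 2 (m + 1)`. The right side
telescopes, which bounds the coefficient sum of `arsinh` without computing it. -/
lemma abs_invSqrtCoeff_div_le (m : ℕ) :
    |invSqrtCoeff m / (m + 1)| ≤ 2 * (|invSqrtCoeff m| - |invSqrtCoeff (m + 2)|) := by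
  have h : |invSqrtCoeff (m + 2)| = (m + 1) / (m + 2) * |invSqrtCoeff m| := by
    rw [invSqrtCoeff, abs_mul, abs_neg, abs_of_nonneg (by positivity)]
  rw [h, abs_div, abs_of_nonneg (by positivity : (0 : ℝ) ≤ (m : ℝ) + 1)]
  have h1 : 2 * (|invSqrtCoeff m| - (m + 1) / (m + 2) * |invSqrtCoeff m|)
      = |invSqrtCoeff m| * (2 / (m + 2)) := by
    field_simp
    ring
  rw [h1, div_eq_mul_one_div]
  gcongr ?_ * ?_
  rw [div_le_div_iff₀ (by positivity) (by positivity)]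
  have : (0 : ℝ) ≤ m := by positivity
  linarith

lemma sum_abs_coeff_arsinhSeries_le (l : ℕ) : ∑ k ∈ range l, |coeff k arsinhSeries| ≤ 2 := by
  have key : ∀ N : ℕ, ∑ m ∈ range N, |invSqrtCoeff m / (m + 1)| ≤
      2 * (1 - |invSqrtCoeff N| - |invSqrtCoeff (N + 1)|) := by
    intro N
    induction N with
    | zero => simp [invSqrtCoeff]
    | succ N ih =>
      rw [sum_range_succ]
      have := abs_invSqrtCoeff_div_le N
      linarith
  rcases l with _ | l
  · simp
  rw [sum_range_succ']
  have h := key l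
  have h1 := abs_nonneg (invSqrtCoeff l)
  have h2 := abs_nonneg (invSqrtCoeff (l + 1))
  simp only [arsinhSeries, coeff_mk, Nat.add_sub_cancel, Nat.add_one_ne_zero, if_false, if_true,
    abs_zero, add_zero]
  push_cast
  linarith

/-- The binomial theorem writes `sinh ^ k` as a combination of exponentials `exp ((2 i - k) z)`,
that is, of evaluations at the nodes `2 i - k`. -/
lemma coeff_sinhSeries_pow (k m : ℕ) :
    coeff m (sinhSeries ^ k) = ∑ i ∈ range (k + 1),
      ((1 / 2) ^ k * (-1) ^ (k - i) * (k.choose i)) * ((2 * i - k : ℝ) ^ m / m.factorial) := by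
  have hexp : ∀ i j : ℕ, rescale (1 : ℝ) (PowerSeries.exp ℝ) ^ i *
      rescale (-1 : ℝ) (PowerSeries.exp ℝ) ^ j = rescale (i - j : ℝ) (PowerSeries.exp ℝ) := by
    intro i j
    rw [← map_pow, ← map_pow, exp_pow_eq_rescale_exp, exp_pow_eq_rescale_exp, rescale_rescale,
      rescale_rescale, exp_mul_exp_eq_exp_add]
    congr 2
    ring
  rw [sinhSeries, mul_pow, ← map_pow, coeff_C_mul, sub_eq_add_neg, add_pow, map_sum, mul_sum]
  refine sum_congr rfl fun i hi => ?_
  have hik : i ≤ k := by simp at hi; omega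
  rw [neg_pow, mul_left_comm, hexp, Nat.cast_sub hik,
    show ((i : ℝ) - (k - i)) = 2 * i - k by ring]
  have h1 : ((-1 : ℝ⟦X⟧) ^ (k - i) * rescale (2 * i - k : ℝ) (PowerSeries.exp ℝ)) * (k.choose i : ℝ⟦X⟧)
      = C ((-1 : ℝ) ^ (k - i) * k.choose i) * rescale (2 * i - k : ℝ) (PowerSeries.exp ℝ) := by
    simp
    ring
  rw [h1, coeff_C_mul, coeff_rescale, coeff_exp]
  simp
  ring

/-- There are nodes in `[-l, l]` and weights of total mass at most `2 ^ s` that compute the `s`-th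
derivative at `0` of polynomials of degree less than `l`. -/
lemma exists_differentiation_weights (l s : ℕ) :
    ∃ (J : Finset (ℕ × ℕ)) (w t : ℕ × ℕ → ℝ), (∀ q ∈ J, |t q| ≤ l) ∧ ∑ q ∈ J, |w q| ≤ 2 ^ s ∧
      ∀ m < l, ∑ q ∈ J, w q * (t q ^ m / m.factorial) = if m = s then 1 else 0 := by
  classical
  let a : ℕ → ℝ := fun k => coeff k (arsinhSeries ^ s)
  refine ⟨(range l).biUnion fun k => (range (k + 1)).image fun i => (k, i),
    fun q => a q.1 * ((1 / 2) ^ q.1 * (-1) ^ (q.1 - q.2) * (q.1.choose q.2)),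
    fun q => 2 * q.2 - q.1, ?_, ?_, ?_⟩
  · rintro ⟨k, i⟩ h
    simp at h
    have h1 : (i : ℝ) ≤ k := by exact_mod_cast (by omega : i ≤ k)
    have h2 : (k : ℝ) ≤ l := by exact_mod_cast h.1.le
    have h3 : (0 : ℝ) ≤ i := by positivity
    rw [abs_le]
    constructor <;> simp only <;> linarith
  all_goals
    have hsum : ∀ φ : ℕ × ℕ → ℝ,
        ∑ q ∈ (range l).biUnion fun k => (range (k + 1)).image fun i => (k, i), φ q =
          ∑ k ∈ range l, ∑ i ∈ range (k + 1), φ (k, i) := by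
      intro φ
      rw [sum_biUnion]
      · refine sum_congr rfl fun k _ => ?_
        rw [sum_image]
        intro i _ j _ h
        simpa using h
      · intro k _ k' _ hk
        rw [Function.onFun, Finset.disjoint_left]
        intro q hq hq'
        simp at hq hq'
        obtain ⟨i, -, rfl⟩ := hq
        obtain ⟨j, -, h⟩ := hq'
        simp at h
        exact hk h.1.symm
  · rw [hsum]
    calc ∑ k ∈ range l, ∑ i ∈ range (k + 1),
          |a k * ((1 / 2) ^ k * (-1) ^ (k - i) * (k.choose i))|
        = ∑ k ∈ range l, |a k| := by
          refine sum_congr rfl fun k _ => ?_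
          -- The binomial coefficients sum to `2 ^ k`, which cancels `(1 / 2) ^ k`: each power of
          -- `sinh` has mass `1`.
          simp only [abs_mul, abs_pow, abs_neg, abs_one, one_pow, mul_one, Nat.abs_cast]
          rw [← mul_sum, ← mul_sum, ← Nat.cast_sum, Nat.sum_range_choose,
            abs_of_pos (by norm_num : (0 : ℝ) < 1 / 2)]
          push_cast
          rw [← mul_pow]
          norm_num
      _ ≤ max 1 (∑ k ∈ range l, |coeff k arsinhSeries|) ^ s := sum_abs_coeff_pow_le _ _ _
      _ ≤ 2 ^ s := by
          gcongr
          exact max_le (by norm_num) (sum_abs_coeff_arsinhSeries_le l)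
  · intro m hm
    rw [hsum]
    -- The moment conditions are the coefficients of `z ^ m` in `arsinh (sinh z) ^ s = z ^ s`.
    have h := coeff_subst_of_lt constantCoeff_sinhSeries (arsinhSeries ^ s) hm
    rw [subst_pow hasSubst_sinhSeries, subst_arsinhSeries, coeff_X_pow] at h
    rw [h]
    refine sum_congr rfl fun k _ => ?_
    rw [coeff_sinhSeries_pow, mul_sum]
    refine sum_congr rfl fun i _ => ?_
    simp only [a]
    ring

end Weights

/-! ### Taylor's formula and Minkowski's integral inequality -/

section Taylor

variable {F : Type*} [NormedAddCommGroup F] [NormedSpace ℝ F]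

lemma hasDerivAt_taylor_sum {φ : ℕ → ℝ → F} {τ : ℝ}
    (h : ∀ m, HasDerivAt (φ m) (φ (m + 1) τ) τ) (l : ℕ) :
    HasDerivAt (fun τ : ℝ => ∑ m ∈ Finset.range (l + 1), ((1 - τ) ^ m / (m.factorial : ℝ)) • φ m τ)
      (((1 - τ) ^ l / (l.factorial : ℝ)) • φ (l + 1) τ) τ := by
  induction l with
  | zero => simpa using h 0
  | succ l ih =>
    have h1 : HasDerivAt (fun τ : ℝ => (1 - τ) ^ (l + 1) / ((l + 1).factorial : ℝ))
        (-((1 - τ) ^ l / l.factorial)) τ := by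
      have := (((hasDerivAt_id τ).const_sub 1).pow (l + 1)).div_const ((l + 1).factorial : ℝ)
      refine this.congr_deriv ?_
      simp [Nat.factorial_succ]
      field_simp
    have h2 := ih.add (h1.smul (h (l + 1)))
    simp_rw [Finset.sum_range_succ _ (l + 1)]
    refine h2.congr_deriv ?_
    rw [neg_smul]
    abel

/-- The integral form of the remainder with `(1 - τ) ^ l` estimated by `1`. The lost factor `l + 1`
is harmless, since only geometric growth matters later. -/
lemma enorm_taylor_remainder_le [CompleteSpace F] {φ : ℕ → ℝ → F}
    (h : ∀ τ ∈ Set.Icc (0 : ℝ) 1, ∀ m, HasDerivAt (φ m) (φ (m + 1) τ) τ) (l : ℕ) :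
    ‖φ 0 1 - ∑ m ∈ Finset.range (l + 1), (1 / m.factorial : ℝ) • φ m 0‖ₑ ≤
      ∫⁻ τ in Set.Ioc (0 : ℝ) 1, ‖(1 / l.factorial : ℝ) • φ (l + 1) τ‖ₑ := by
  have hc : ContinuousOn (fun τ => ((1 - τ) ^ l / (l.factorial : ℝ)) • φ (l + 1) τ)
      (Set.uIcc 0 1) := by
    rw [Set.uIcc_of_le zero_le_one]
    refine ContinuousOn.smul (by fun_prop) fun τ hτ => ?_
    exact (h τ hτ (l + 1)).continuousAt.continuousWithinAt
  have hint := intervalIntegral.integral_eq_sub_of_hasDerivAt (a := 0) (b := 1)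
    (fun τ hτ => hasDerivAt_taylor_sum (h τ (by rwa [Set.uIcc_of_le zero_le_one] at hτ)) l)
    hc.intervalIntegrable
  have h1 : ∑ m ∈ Finset.range (l + 1), ((1 - 1 : ℝ) ^ m / m.factorial) • φ m 1 = φ 0 1 := by
    rw [Finset.sum_range_succ']
    simp
  simp only [h1, sub_zero, one_pow] at hint
  rw [← hint, intervalIntegral.integral_of_le zero_le_one]
  refine (enorm_integral_le_lintegral_enorm _).trans ?_
  refine setLIntegral_mono' measurableSet_Ioc fun τ hτ => ?_
  rw [enorm_smul, enorm_smul]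
  gcongr
  rw [Real.enorm_eq_ofReal_abs, Real.enorm_eq_ofReal_abs]
  apply ENNReal.ofReal_le_ofReal
  rw [abs_of_nonneg, abs_of_nonneg (by positivity)]
  · gcongr
    exact pow_le_one₀ (by linarith [hτ.2]) (by linarith [hτ.1])
  · have : 0 ≤ 1 - τ := by linarith [hτ.2]
    positivity

end Taylor

/-- An average over a probability space has norm at most the largest norm of the averaged functions:
Jensen and Tonelli for finite `p`, and interchange of almost-everywhere quantifiers for `p = ∞`. -/
lemma eLpNorm_le_of_enorm_le_lintegral {α β F F' : Type*} [MeasurableSpace α] [MeasurableSpace β]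
    [NormedAddCommGroup F] [NormedAddCommGroup F'] {μ : Measure α} [SFinite μ] {ν : Measure β}
    [IsProbabilityMeasure ν] {p : ℝ≥0∞} (hp : 1 ≤ p) {f : α → F} {G : β → α → F'}
    (hG : StronglyMeasurable fun q : α × β => G q.2 q.1) {B : ℝ≥0∞}
    (h : ∀ᵐ x ∂μ, ‖f x‖ₑ ≤ ∫⁻ τ, ‖G τ x‖ₑ ∂ν) (hB : ∀ τ, eLpNorm (G τ) p μ ≤ B) :
    eLpNorm f p μ ≤ B := by
  have hm : Measurable fun q : α × β => ‖G q.2 q.1‖ₑ := hG.enorm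
  by_cases hpt : p = (⊤ : ℝ≥0∞)
  · subst hpt
    rw [eLpNorm_exponent_top]
    refine essSup_le_of_ae_le _ ?_
    have h1 : ∀ᵐ x ∂μ, ∀ᵐ τ ∂ν, ‖G τ x‖ₑ ≤ B := by
      have hms : MeasurableSet {q : α × β | ‖G q.2 q.1‖ₑ ≤ B} :=
        measurableSet_le hm measurable_const
      rw [Measure.ae_ae_comm hms]
      refine Eventually.of_forall fun τ => ?_
      have := hB τ
      rw [eLpNorm_exponent_top] at this
      filter_upwards [ae_le_eLpNormEssSup (f := G τ) (μ := μ)] with x hx using hx.trans this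
    filter_upwards [h, h1] with x hx hx1
    refine hx.trans ((lintegral_mono_ae hx1).trans ?_)
    simp
  · have hp0 : p ≠ 0 := (one_pos.trans_le hp).ne'
    have hpr : 1 ≤ p.toReal := by
      rw [← ENNReal.toReal_one]
      exact ENNReal.toReal_mono hpt hp
    have hpos : 0 < p.toReal := one_pos.trans_le hpr
    have key : ∀ x, (∫⁻ τ, ‖G τ x‖ₑ ∂ν) ^ p.toReal ≤ ∫⁻ τ, ‖G τ x‖ₑ ^ p.toReal ∂ν := by
      intro x
      have h1 := eLpNorm'_le_eLpNorm'_of_exponent_le (f := fun τ => G τ x) one_pos hpr ν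
        (hG.comp_measurable measurable_prodMk_left).aestronglyMeasurable
      simp only [eLpNorm'_eq_lintegral_enorm, ENNReal.rpow_one, div_one] at h1
      calc _ ≤ ((∫⁻ τ, ‖G τ x‖ₑ ^ p.toReal ∂ν) ^ (1 / p.toReal)) ^ p.toReal := by gcongr
        _ = _ := by rw [← ENNReal.rpow_mul, one_div_mul_cancel hpos.ne', ENNReal.rpow_one]
    have hB' : ∀ τ, ∫⁻ x, ‖G τ x‖ₑ ^ p.toReal ∂μ ≤ B ^ p.toReal := by
      intro τ
      have := hB τ
      rw [eLpNorm_eq_lintegral_rpow_enorm_toReal hp0 hpt] at this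
      calc _ = ((∫⁻ x, ‖G τ x‖ₑ ^ p.toReal ∂μ) ^ (1 / p.toReal)) ^ p.toReal := by
            rw [← ENNReal.rpow_mul, one_div_mul_cancel hpos.ne', ENNReal.rpow_one]
        _ ≤ _ := by gcongr
    rw [eLpNorm_eq_lintegral_rpow_enorm_toReal hp0 hpt]
    calc (∫⁻ x, ‖f x‖ₑ ^ p.toReal ∂μ) ^ (1 / p.toReal)
        ≤ (∫⁻ x, ∫⁻ τ, ‖G τ x‖ₑ ^ p.toReal ∂ν ∂μ) ^ (1 / p.toReal) := by
          gcongr ?_ ^ _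
          refine lintegral_mono_ae ?_
          filter_upwards [h] with x hx
          exact (ENNReal.rpow_le_rpow hx hpos.le).trans (key x)
      _ = (∫⁻ τ, ∫⁻ x, ‖G τ x‖ₑ ^ p.toReal ∂μ ∂ν) ^ (1 / p.toReal) := by
          rw [lintegral_lintegral_swap]
          exact (hm.pow_const _).aemeasurable
      _ ≤ (∫⁻ _, B ^ p.toReal ∂ν) ^ (1 / p.toReal) := by
          gcongr ?_ ^ _
          exact lintegral_mono hB'
      _ = B := by
          rw [lintegral_const, measure_univ, mul_one, ← ENNReal.rpow_mul,
            mul_one_div_cancel hpos.ne', ENNReal.rpow_one]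

/-! ### Interpolation in one direction -/

section OneDirection

variable {n : ℕ} {𝕜 : Type*} [RCLike 𝕜]

lemma contDiffOn_partialDeriv {f : EuclideanSpace ℝ (Fin n) → 𝕜}
    {U : Set (EuclideanSpace ℝ (Fin n))} (hU : IsOpen U) (hf : ContDiffOn ℝ ∞ f U) (i : Fin n) :
    ContDiffOn ℝ ∞ (partialDeriv i f) U :=
  ((contDiffOn_infty_iff_fderiv_of_isOpen hU).1 hf).2.clm_apply contDiffOn_const

lemma contDiffOn_iterate_partialDeriv {f : EuclideanSpace ℝ (Fin n) → 𝕜}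
    {U : Set (EuclideanSpace ℝ (Fin n))} (hU : IsOpen U) (hf : ContDiffOn ℝ ∞ f U) (i : Fin n)
    (m : ℕ) : ContDiffOn ℝ ∞ ((partialDeriv i)^[m] f) U := by
  induction m with
  | zero => exact hf
  | succ m ih =>
    rw [Function.iterate_succ_apply']
    exact contDiffOn_partialDeriv hU ih i

lemma hasDerivAt_along_line {f : EuclideanSpace ℝ (Fin n) → 𝕜}
    {U : Set (EuclideanSpace ℝ (Fin n))} (hU : IsOpen U) (hf : ContDiffOn ℝ ∞ f U) (i : Fin n)
    (x : EuclideanSpace ℝ (Fin n)) (u τ : ℝ)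
    (hx : x + (τ * u) • EuclideanSpace.single i (1 : ℝ) ∈ U) (m : ℕ) :
    HasDerivAt
      (fun τ => u ^ m • (partialDeriv i)^[m] f (x + (τ * u) • EuclideanSpace.single i (1 : ℝ)))
      (u ^ (m + 1) •
        (partialDeriv i)^[m + 1] f (x + (τ * u) • EuclideanSpace.single i (1 : ℝ))) τ := by
  have h1 : HasFDerivAt ((partialDeriv i)^[m] f) (fderiv ℝ ((partialDeriv i)^[m] f)
      (x + (τ * u) • EuclideanSpace.single i (1 : ℝ)))
      (x + (τ * u) • EuclideanSpace.single i (1 : ℝ)) :=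
    (((contDiffOn_iterate_partialDeriv hU hf i m).contDiffAt
      (hU.mem_nhds hx)).differentiableAt (by simp)).hasFDerivAt
  have h2 : HasDerivAt (fun τ : ℝ => x + (τ * u) • EuclideanSpace.single i (1 : ℝ))
      (u • EuclideanSpace.single i (1 : ℝ)) τ := by
    have := (((hasDerivAt_id τ).mul_const u).smul_const
      (EuclideanSpace.single i (1 : ℝ))).const_add x
    simpa using this
  have h3 := (h1.comp_hasDerivAt τ h2).const_smul (u ^ m)
  refine h3.congr_deriv ?_
  rw [map_smul, smul_smul, ← pow_succ, Function.iterate_succ_apply']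
  rfl

lemma stronglyMeasurable_indicator_of_continuousOn {f : EuclideanSpace ℝ (Fin n) → 𝕜}
    {W : Set (EuclideanSpace ℝ (Fin n))} (hW : MeasurableSet W) (hf : ContinuousOn f W) :
    StronglyMeasurable (W.indicator f) := by
  classical
  rw [stronglyMeasurable_iff_measurable, ← Set.piecewise_eq_indicator]
  exact hf.measurable_piecewise continuous_zero.continuousOn hW

lemma eLpNorm_restrict_translate_le {F : Type*} [NormedAddCommGroup F] (p : ℝ≥0∞)
    {g : EuclideanSpace ℝ (Fin n) → F} (hg : StronglyMeasurable g)
    (W : Set (EuclideanSpace ℝ (Fin n))) (v : EuclideanSpace ℝ (Fin n)) :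
    eLpNorm (fun x => g (x + v)) p (volume.restrict W) ≤ eLpNorm g p volume := by
  refine (eLpNorm_mono_measure _ Measure.restrict_le_self).trans_eq ?_
  exact eLpNorm_comp_measurePreserving hg.aestronglyMeasurable
    (measurePreserving_add_right volume v)

/-- This fixes the step `1 / (6 T)`: with nodes at distance up to `(l + 1) / (6 T)`, the Taylor
remainder is no larger than the bound for `g` itself. -/
lemma pow_self_le (l : ℕ) : ((l + 1 : ℕ) : ℝ) ^ (l + 1) ≤ 6 ^ (l + 1) * l.factorial := by
  have h1 := Real.pow_div_factorial_le_exp ((l + 1 : ℕ) : ℝ) (by positivity) (l + 1)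
  have h2 : Real.exp ((l + 1 : ℕ) : ℝ) ≤ 3 ^ (l + 1) := by
    rw [← Real.exp_one_pow]
    gcongr
    exact Real.exp_one_lt_three.le
  have h3 : ((l + 1 : ℕ) : ℝ) ≤ 2 ^ (l + 1) := by exact_mod_cast Nat.lt_two_pow_self.le
  rw [div_le_iff₀ (by positivity)] at h1
  calc _ ≤ _ := h1
    _ ≤ 3 ^ (l + 1) * ((l + 1).factorial : ℝ) := by gcongr
    _ = 3 ^ (l + 1) * (((l + 1 : ℕ) : ℝ) * l.factorial) := by rw [Nat.factorial_succ]; push_cast; ring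
    _ ≤ 3 ^ (l + 1) * (2 ^ (l + 1) * l.factorial) := by gcongr
    _ = _ := by rw [show (6 : ℝ) = 3 * 2 by norm_num, mul_pow]; ring

lemma eLpNorm_taylor_remainder_le {p : ℝ≥0∞} (hp : 1 ≤ p)
    {W W' : Set (EuclideanSpace ℝ (Fin n))} (hW : IsOpen W) (hW' : MeasurableSet W') (i : Fin n)
    {g : EuclideanSpace ℝ (Fin n) → 𝕜} (hg : ContDiffOn ℝ ∞ g W) (l : ℕ) {r u B : ℝ}
    (hWW' : ∀ x ∈ W', ∀ t : ℝ, |t| ≤ r → x + t • EuclideanSpace.single i (1 : ℝ) ∈ W)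
    (hu : |u| ≤ r)
    (hB : eLpNorm ((partialDeriv i)^[l + 1] g) p (volume.restrict W) ≤ ENNReal.ofReal B) :
    eLpNorm (fun x => g (x + u • EuclideanSpace.single i (1 : ℝ)) -
        ∑ m ∈ Finset.range (l + 1), (u ^ m / m.factorial) • (partialDeriv i)^[m] g x) p
        (volume.restrict W') ≤
      ENNReal.ofReal (r ^ (l + 1) / l.factorial * B) := by
  -- Extension by zero makes the function measurable on the whole space, so translation invariance
  -- of the measure applies.
  set D := W.indicator ((partialDeriv i)^[l + 1] g) with hD
  have hDm : StronglyMeasurable D := by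
    exact stronglyMeasurable_indicator_of_continuousOn hW.measurableSet
      (contDiffOn_iterate_partialDeriv hW hg i (l + 1)).continuousOn
  have hDB : eLpNorm D p volume ≤ ENNReal.ofReal B := by
    rwa [hD, eLpNorm_indicator_eq_eLpNorm_restrict hW.measurableSet]
  have hmem : ∀ x ∈ W', ∀ τ ∈ Set.Icc (0 : ℝ) 1,
      x + (τ * u) • EuclideanSpace.single i (1 : ℝ) ∈ W := by
    intro x hx τ hτ
    refine hWW' x hx _ (le_trans ?_ hu)
    rw [abs_mul, abs_of_nonneg hτ.1]
    exact mul_le_of_le_one_left (abs_nonneg _) hτ.2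
  have : IsProbabilityMeasure (volume.restrict (Set.Ioc (0 : ℝ) 1)) := ⟨by simp⟩
  refine eLpNorm_le_of_enorm_le_lintegral hp (ν := volume.restrict (Set.Ioc (0 : ℝ) 1))
    (G := fun τ x => (1 / l.factorial * u ^ (l + 1) : ℝ) •
      D (x + (τ * u) • EuclideanSpace.single i (1 : ℝ))) ?_ ?_ ?_
  · refine StronglyMeasurable.const_smul (hDm.comp_measurable ?_) _
    fun_prop
  · filter_upwards [ae_restrict_mem hW'] with x hx
    have h := enorm_taylor_remainder_le (φ := fun m τ => u ^ m • (partialDeriv i)^[m] g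
      (x + (τ * u) • EuclideanSpace.single i (1 : ℝ)))
      (fun τ hτ m => hasDerivAt_along_line hW hg i x u τ (hmem x hx τ hτ) m) l
    simp only [zero_mul, zero_smul, add_zero, one_mul, smul_smul, pow_zero, one_smul,
      Function.iterate_zero, id] at h
    refine (le_of_eq ?_).trans (h.trans (le_of_eq ?_))
    · congr 2
      refine Finset.sum_congr rfl fun m _ => ?_
      congr 1
      ring
    · refine setLIntegral_congr_fun measurableSet_Ioc fun τ hτ => ?_
      simp only [hD]
      rw [Set.indicator_of_mem (hmem x hx τ (Set.Ioc_subset_Icc_self hτ))]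
  · intro τ
    rw [show (fun x => (1 / l.factorial * u ^ (l + 1) : ℝ) •
      D (x + (τ * u) • EuclideanSpace.single i (1 : ℝ))) = (1 / l.factorial * u ^ (l + 1) : ℝ) •
      fun x => D (x + (τ * u) • EuclideanSpace.single i (1 : ℝ)) from rfl, eLpNorm_const_smul,
      Real.enorm_eq_ofReal_abs]
    have hr : 0 ≤ r := (abs_nonneg _).trans hu
    rw [ENNReal.ofReal_mul (by positivity)]
    refine mul_le_mul' (ENNReal.ofReal_le_ofReal ?_)
      ((eLpNorm_restrict_translate_le p hDm W' _).trans hDB)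
    rw [abs_mul, abs_pow, abs_of_nonneg (by positivity : (0 : ℝ) ≤ 1 / l.factorial),
      div_eq_mul_one_div (r ^ (l + 1)), mul_comm]
    exact mul_le_mul_of_nonneg_right (pow_le_pow_left₀ (abs_nonneg _) hu _) (by positivity)

/-- A Landau-Kolmogorov inequality in a coordinate direction, with constants that do not depend
on the order `l` of the highest derivative. -/
lemma eLpNorm_iterate_partialDeriv_le {p : ℝ≥0∞} (hp : 1 ≤ p)
    {W W' : Set (EuclideanSpace ℝ (Fin n))} (hW : IsOpen W) (hW' : MeasurableSet W') (i : Fin n)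
    {g : EuclideanSpace ℝ (Fin n) → 𝕜} (hg : ContDiffOn ℝ ∞ g W) {l s : ℕ} (hs : s < l)
    {T A : ℝ} (hT : 0 < T) (hA : 0 ≤ A)
    (hWW' : ∀ x ∈ W', ∀ t : ℝ, |t| ≤ l / (6 * T) →
      x + t • EuclideanSpace.single i (1 : ℝ) ∈ W)
    (h0 : eLpNorm g p (volume.restrict W) ≤ ENNReal.ofReal A)
    (hl : eLpNorm ((partialDeriv i)^[l] g) p (volume.restrict W) ≤ ENNReal.ofReal (A * T ^ l)) :
    eLpNorm ((partialDeriv i)^[s] g) p (volume.restrict W') ≤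
      ENNReal.ofReal (2 * A * (12 * T) ^ s) := by
  obtain ⟨l, rfl⟩ : ∃ l', l = l' + 1 := ⟨l - 1, by omega⟩
  obtain ⟨J, w, t, ht, hw, hmom⟩ := exists_differentiation_weights (l + 1) s
  set e : EuclideanSpace ℝ (Fin n) := EuclideanSpace.single i (1 : ℝ) with he
  set h : ℝ := 1 / (6 * T) with hh
  have hpos : 0 < h := by positivity
  have hth : ∀ q ∈ J, |t q * h| ≤ ((l + 1 : ℕ) : ℝ) / (6 * T) := by
    intro q hq
    rw [abs_mul, abs_of_pos hpos, div_eq_mul_one_div _ (6 * T), ← hh]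
    exact mul_le_mul_of_nonneg_right (ht q hq) hpos.le
  have hWsub : W' ⊆ W := by
    intro x hx
    simpa using hWW' x hx 0 (by simp; positivity)
  have hcont : ∀ m, ContinuousOn ((partialDeriv i)^[m] g) W' := fun m =>
    (contDiffOn_iterate_partialDeriv hW hg i m).continuousOn.mono hWsub
  set R : ℕ × ℕ → EuclideanSpace ℝ (Fin n) → 𝕜 := fun q x => g (x + (t q * h) • e) -
    ∑ m ∈ Finset.range (l + 1), ((t q * h) ^ m / m.factorial) • (partialDeriv i)^[m] g x with hR
  have hgc : ∀ q ∈ J, ContinuousOn (fun x => g (x + (t q * h) • e)) W' := fun q hq =>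
    hg.continuousOn.comp (by fun_prop) fun x hx => hWW' x hx _ (hth q hq)
  have hRc : ∀ q ∈ J, ContinuousOn (R q) W' := fun q hq =>
    (hgc q hq).sub (continuousOn_finsetSum _ fun m _ => (hcont m).const_smul _)
  have hRB : ∀ q ∈ J, eLpNorm (R q) p (volume.restrict W') ≤ ENNReal.ofReal A := by
    intro q hq
    refine (eLpNorm_taylor_remainder_le hp hW hW' i hg l hWW' (hth q hq) hl).trans
      (ENNReal.ofReal_le_ofReal ?_)
    have h1 := pow_self_le l
    rw [div_pow, mul_pow]
    calc _ = (((l + 1 : ℕ) : ℝ) ^ (l + 1) / (6 ^ (l + 1) * l.factorial)) * A := by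
          field_simp
      _ ≤ 1 * A := by
          gcongr
          exact div_le_one_of_le₀ h1 (by positivity)
      _ = A := one_mul A
  have hgB : ∀ q ∈ J, eLpNorm (fun x => g (x + (t q * h) • e)) p (volume.restrict W') ≤
      ENNReal.ofReal A := by
    intro q hq
    have hGm : StronglyMeasurable (W.indicator g) :=
      stronglyMeasurable_indicator_of_continuousOn hW.measurableSet hg.continuousOn
    calc _ = eLpNorm (fun x => W.indicator g (x + (t q * h) • e)) p (volume.restrict W') := by
          refine eLpNorm_congr_ae ?_
          filter_upwards [ae_restrict_mem hW'] with x hx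
          rw [Set.indicator_of_mem (hWW' x hx _ (hth q hq))]
      _ ≤ _ := eLpNorm_restrict_translate_le p hGm W' _
      _ ≤ _ := by rwa [eLpNorm_indicator_eq_eLpNorm_restrict hW.measurableSet]
  -- Here `g` minus the remainder is the Taylor polynomial, on which the weights are exact; only the
  -- term of degree `s` survives.
  have hid : ∀ x, h ^ s • (partialDeriv i)^[s] g x =
      ∑ q ∈ J, w q • (g (x + (t q * h) • e) - R q x) := by
    intro x
    simp only [hR, sub_sub_cancel, Finset.smul_sum]
    rw [Finset.sum_comm]
    have : ∀ m ∈ Finset.range (l + 1), ∑ q ∈ J,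
        w q • ((t q * h) ^ m / (m.factorial : ℝ)) • (partialDeriv i)^[m] g x =
        if m = s then h ^ m • (partialDeriv i)^[m] g x else 0 := by
      intro m hm
      simp only [smul_smul]
      rw [← Finset.sum_smul]
      have h2 : ∑ q ∈ J, w q * ((t q * h) ^ m / (m.factorial : ℝ)) =
          h ^ m * ∑ q ∈ J, w q * (t q ^ m / m.factorial) := by
        rw [Finset.mul_sum]
        refine Finset.sum_congr rfl fun q _ => ?_
        rw [mul_pow]
        ring
      rw [h2, hmom m (Finset.mem_range.1 hm)]
      split_ifs <;> simp
    rw [Finset.sum_congr rfl this, Finset.sum_ite_eq', if_pos (Finset.mem_range.2 hs)]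
  -- The mass `2 ^ s` meets the bound `A` for the translate and `A` for the remainder. Dividing by
  -- `h ^ s` turns `2 ^ s` into `(12 T) ^ s`.
  have hfin : eLpNorm (h ^ s • (partialDeriv i)^[s] g) p (volume.restrict W') ≤
      ENNReal.ofReal (2 ^ s * (A + A)) := by
    have h1 : h ^ s • (partialDeriv i)^[s] g =
        ∑ q ∈ J, w q • ((fun x => g (x + (t q * h) • e)) - R q) := by
      ext x
      simp only [Pi.smul_apply, Finset.sum_apply, Pi.sub_apply]
      exact hid x
    rw [h1]
    have hm1 : ∀ q ∈ J, AEStronglyMeasurable (fun x => g (x + (t q * h) • e))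
        (volume.restrict W') := fun q hq => (hgc q hq).aestronglyMeasurable hW'
    have hm2 : ∀ q ∈ J, AEStronglyMeasurable (R q) (volume.restrict W') :=
      fun q hq => (hRc q hq).aestronglyMeasurable hW'
    refine (eLpNorm_sum_le (fun q hq => ((hm1 q hq).sub (hm2 q hq)).const_smul _) hp).trans ?_
    calc _ ≤ ∑ q ∈ J, ENNReal.ofReal (|w q| * (A + A)) := by
          refine Finset.sum_le_sum fun q hq => ?_
          rw [eLpNorm_const_smul, Real.enorm_eq_ofReal_abs, ENNReal.ofReal_mul (abs_nonneg _),
            ENNReal.ofReal_add hA hA]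
          gcongr
          exact (eLpNorm_sub_le (hm1 q hq) (hm2 q hq) hp).trans (add_le_add (hgB q hq) (hRB q hq))
      _ = ENNReal.ofReal ((∑ q ∈ J, |w q|) * (A + A)) := by
          rw [Finset.sum_mul, ENNReal.ofReal_sum_of_nonneg fun q _ => by positivity]
      _ ≤ _ := by gcongr
  rw [eLpNorm_const_smul, Real.enorm_eq_ofReal_abs, abs_of_nonneg (by positivity)] at hfin
  have hne : ENNReal.ofReal (h ^ s) ≠ 0 := by
    simp only [ne_eq, ENNReal.ofReal_eq_zero, not_le]
    positivity
  rw [← ENNReal.mul_le_mul_iff_right hne ENNReal.ofReal_ne_top, ← ENNReal.ofReal_mul (by positivity)]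
  refine hfin.trans_eq ?_
  congr 1
  have : h * (12 * T) = 2 := by
    rw [hh]
    field_simp
    norm_num
  calc 2 ^ s * (A + A) = 2 * A * (h * (12 * T)) ^ s := by rw [this]; ring
    _ = _ := by rw [mul_pow]; ring

end OneDirection

/-! ### Multi-indices and iterated partial derivatives -/

section MultiDeriv

variable {n : ℕ} {𝕜 : Type*} [RCLike 𝕜]

lemma order_add (α β : Fin n → ℕ) : order (α + β) = order α + order β := by
  simp [order, Finset.sum_add_distrib]

lemma order_zero : order (0 : Fin n → ℕ) = 0 := by simp [order]

lemma order_single (i : Fin n) (m : ℕ) : order (Pi.single i m) = m := by simp [order]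

lemma exists_le_of_le_order (α : Fin n → ℕ) {k : ℕ} (hk : k ≤ order α) :
    ∃ β γ : Fin n → ℕ, α = β + γ ∧ order β = k := by
  induction k with
  | zero => exact ⟨0, α, by simp, order_zero⟩
  | succ k ih =>
    obtain ⟨β, γ, rfl, hβ⟩ := ih (by omega)
    rw [order_add] at hk
    obtain ⟨i, hi⟩ : ∃ i, γ i ≠ 0 := by
      by_contra! h
      have : order γ = 0 := by simp [order, h]
      omega
    refine ⟨β + Pi.single i 1, γ - Pi.single i 1, ?_, by rw [order_add, order_single, hβ]⟩
    ext j
    by_cases hj : j = i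
    · subst hj
      simp
      omega
    · simp [hj]

variable {U : Set (EuclideanSpace ℝ (Fin n))} {f g : EuclideanSpace ℝ (Fin n) → 𝕜}

lemma partialDeriv_congr (hU : IsOpen U) (h : Set.EqOn f g U) (i : Fin n) :
    Set.EqOn (partialDeriv i f) (partialDeriv i g) U := by
  intro x hx
  simp only [partialDeriv]
  rw [(h.eventuallyEq_of_mem (hU.mem_nhds hx)).fderiv_eq]

lemma iterate_partialDeriv_congr (hU : IsOpen U) (h : Set.EqOn f g U) (i : Fin n) (m : ℕ) :
    Set.EqOn ((partialDeriv i)^[m] f) ((partialDeriv i)^[m] g) U := by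
  induction m with
  | zero => exact h
  | succ m ih =>
    simp only [Function.iterate_succ_apply']
    exact partialDeriv_congr hU ih i

lemma partialDeriv_comm (hU : IsOpen U) (hf : ContDiffOn ℝ ∞ f U) (i j : Fin n) :
    Set.EqOn (partialDeriv i (partialDeriv j f)) (partialDeriv j (partialDeriv i f)) U := by
  intro x hx
  have hfx : ContDiffAt ℝ ∞ f x := hf.contDiffAt (hU.mem_nhds hx)
  have hd : DifferentiableAt ℝ (fderiv ℝ f) x :=
    (hfx.fderiv_right (m := 1) (WithTop.coe_le_coe.2 le_top)).differentiableAt (by simp)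
  have h : ∀ a b : Fin n, partialDeriv a (partialDeriv b f) x =
      fderiv ℝ (fderiv ℝ f) x (EuclideanSpace.single a 1) (EuclideanSpace.single b 1) := by
    intro a b
    change fderiv ℝ (fun y => fderiv ℝ f y (EuclideanSpace.single b 1)) x _ = _
    rw [fderiv_clm_apply hd (differentiableAt_const _)]
    simp
  rw [h, h]
  exact (hfx.isSymmSndFDerivAt (by simpa using WithTop.coe_le_coe.2 (le_top (a := (2 : ℕ∞))))).eq _ _

lemma partialDeriv_iterate_comm (hU : IsOpen U) (hf : ContDiffOn ℝ ∞ f U) (i j : Fin n) (m : ℕ) :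
    Set.EqOn (partialDeriv i ((partialDeriv j)^[m] f)) ((partialDeriv j)^[m] (partialDeriv i f))
      U := by
  induction m with
  | zero => exact fun _ _ => rfl
  | succ m ih =>
    simp only [Function.iterate_succ_apply']
    exact (partialDeriv_comm hU (contDiffOn_iterate_partialDeriv hU hf j m) i j).trans
      (partialDeriv_congr hU ih j)

lemma contDiffOn_foldr_partialDeriv (hU : IsOpen U) (hf : ContDiffOn ℝ ∞ f U) (α : Fin n → ℕ)
    (L : List (Fin n)) :
    ContDiffOn ℝ ∞ (L.foldr (fun i g => (partialDeriv i)^[α i] g) f) U := by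
  induction L with
  | nil => exact hf
  | cons j L ih => exact contDiffOn_iterate_partialDeriv hU ih j _

lemma contDiffOn_multiDeriv (hU : IsOpen U) (hf : ContDiffOn ℝ ∞ f U) (α : Fin n → ℕ) :
    ContDiffOn ℝ ∞ (multiDeriv α f) U :=
  contDiffOn_foldr_partialDeriv hU hf α _

lemma foldr_partialDeriv_single_of_notMem (α : Fin n → ℕ) {L : List (Fin n)} {i : Fin n}
    (hi : i ∉ L) (m : ℕ) :
    L.foldr (fun j g => (partialDeriv j)^[(α + Pi.single i m : Fin n → ℕ) j] g) f =
      L.foldr (fun j g => (partialDeriv j)^[α j] g) f := by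
  induction L with
  | nil => rfl
  | cons j L ih =>
    simp only [List.mem_cons, not_or] at hi
    simp only [List.foldr_cons]
    rw [ih hi.2]
    simp [Ne.symm hi.1]

lemma foldr_partialDeriv_add_single (hU : IsOpen U) (hf : ContDiffOn ℝ ∞ f U) (α : Fin n → ℕ)
    {L : List (Fin n)} (hL : L.Nodup) {i : Fin n} (hi : i ∈ L) :
    Set.EqOn (L.foldr (fun j g => (partialDeriv j)^[(α + Pi.single i 1 : Fin n → ℕ) j] g) f)
      (partialDeriv i (L.foldr (fun j g => (partialDeriv j)^[α j] g) f)) U := by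
  induction L with
  | nil => simp at hi
  | cons j L ih =>
    rw [List.nodup_cons] at hL
    simp only [List.foldr_cons]
    by_cases hij : i = j
    · subst hij
      rw [foldr_partialDeriv_single_of_notMem α hL.1]
      simp only [Pi.add_apply, Pi.single_eq_same, Function.iterate_succ_apply']
      exact fun _ _ => rfl
    · have hi' : i ∈ L := by simpa [hij] using hi
      have h1 := iterate_partialDeriv_congr hU (ih hL.2 hi') j (α j)
      have h2 := partialDeriv_iterate_comm hU (contDiffOn_foldr_partialDeriv hU hf α L) i j (α j)
      simp only [Pi.add_apply, Pi.single_eq_of_ne (Ne.symm hij), add_zero]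
      exact h1.trans h2.symm

lemma multiDeriv_zero : multiDeriv 0 f = f := by
  have : ∀ L : List (Fin n),
      L.foldr (fun i g => (partialDeriv i)^[(0 : Fin n → ℕ) i] g) f = f := by
    intro L
    induction L with
    | nil => rfl
    | cons j L ih => simp
  exact this _

lemma multiDeriv_add_single (hU : IsOpen U) (hf : ContDiffOn ℝ ∞ f U) (α : Fin n → ℕ) (i : Fin n)
    (m : ℕ) :
    Set.EqOn (multiDeriv (α + Pi.single i m) f) ((partialDeriv i)^[m] (multiDeriv α f)) U := by
  induction m with
  | zero =>
    simp only [Pi.single_zero, add_zero, Function.iterate_zero, id]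
    exact fun _ _ => rfl
  | succ m ih =>
    rw [show Pi.single i (m + 1) = Pi.single i m + (Pi.single i 1 : Fin n → ℕ) by
      rw [← Pi.single_add], ← add_assoc, Function.iterate_succ_apply']
    have h : Set.EqOn (multiDeriv (α + Pi.single i m + Pi.single i 1) f)
        (partialDeriv i (multiDeriv (α + Pi.single i m) f)) U :=
      foldr_partialDeriv_add_single hU hf _ (List.nodup_finRange n) (List.mem_finRange i)
    exact h.trans (partialDeriv_congr hU ih i)

/-! ### Interpolation of mixed partial derivatives -/

/-- Induction over the coordinates that occur in `γ`. Each one costs a factor `2` and one shrinking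
of the domain, so the total cost depends on the dimension and not on `l`. -/
lemma eLpNorm_multiDeriv_add_le {p : ℝ≥0∞} (hp : 1 ≤ p)
    {W : ℕ → Set (EuclideanSpace ℝ (Fin n))} (hW : ∀ q, IsOpen (W q))
    (hf : ContDiffOn ℝ ∞ f (W 0)) {l : ℕ} {T A : ℝ} (hT : 0 < T) (hA : 0 ≤ A)
    (hWs : ∀ q, ∀ x ∈ W (q + 1), ∀ i : Fin n, ∀ t : ℝ, |t| ≤ l / (6 * T) →
      x + t • EuclideanSpace.single i (1 : ℝ) ∈ W q)
    {β : Fin n → ℕ}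
    (h0 : eLpNorm (multiDeriv β f) p (volume.restrict (W 0)) ≤ ENNReal.ofReal A)
    (hl : ∀ γ : Fin n → ℕ, order γ = order β + l →
      eLpNorm (multiDeriv γ f) p (volume.restrict (W 0)) ≤ ENNReal.ofReal (A * T ^ l))
    (S : Finset (Fin n)) (γ : Fin n → ℕ) (hγ : ∀ i ∉ S, γ i = 0) (hγl : order γ < l) :
    eLpNorm (multiDeriv (β + γ) f) p (volume.restrict (W S.card)) ≤
      ENNReal.ofReal (2 ^ S.card * A * (12 * T) ^ order γ) := by
  classical
  induction S using Finset.induction_on generalizing γ with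
  | empty =>
    obtain rfl : γ = 0 := funext fun i => hγ i (by simp)
    simpa [order_zero] using h0
  | insert q S hq ih =>
    set γ' : Fin n → ℕ := Function.update γ q 0 with hγ'
    have hsplit : γ = γ' + Pi.single q (γ q) := by
      ext j
      by_cases hj : j = q
      · subst hj; simp [hγ']
      · simp [hγ', hj]
    have hord : order γ = order γ' + γ q := by
      conv_lhs => rw [hsplit]
      rw [order_add, order_single]
    have hmono : ∀ r, W (r + 1) ⊆ W r := by
      intro r x hx
      simpa using hWs r x hx q 0 (by simp; positivity)
    have hmono0 : ∀ r, W r ⊆ W 0 := by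
      intro r
      induction r with
      | zero => exact subset_rfl
      | succ r ihr => exact (hmono r).trans ihr
    have ih' := ih γ' (by
      intro i hi
      by_cases hiq : i = q
      · subst hiq; simp [hγ']
      · simp only [hγ', Function.update_of_ne hiq]
        exact hγ i (by simp [hiq, hi])) (by omega)
    rw [Finset.card_insert_of_notMem hq]
    have hE : Set.EqOn (multiDeriv (β + γ) f) ((partialDeriv q)^[γ q] (multiDeriv (β + γ') f))
        (W 0) := by
      rw [hsplit, ← add_assoc]
      simpa [hγ'] using multiDeriv_add_single (hW 0) hf (β + γ') q (γ q)
    have hcongr : ∀ {g₁ g₂ : EuclideanSpace ℝ (Fin n) → 𝕜} (r : ℕ), Set.EqOn g₁ g₂ (W 0) →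
        eLpNorm g₁ p (volume.restrict (W r)) = eLpNorm g₂ p (volume.restrict (W r)) := by
      intro g₁ g₂ r h
      refine eLpNorm_congr_ae ?_
      filter_upwards [ae_restrict_mem (hW r).measurableSet] with x hx using h (hmono0 r hx)
    rw [hcongr _ hE]
    -- After differentiating by `γ'`, only `l - |γ'|` further derivatives in direction `q` are
    -- needed to reach the controlled order `|β| + l`.
    refine (eLpNorm_iterate_partialDeriv_le hp (hW S.card) (hW (S.card + 1)).measurableSet q
      ((contDiffOn_multiDeriv (hW 0) hf _).mono (hmono0 _)) (l := l - order γ') (s := γ q)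
      (by omega) hT (A := 2 ^ S.card * A * (12 * T) ^ order γ') (by positivity) ?_ ih' ?_).trans
      (ENNReal.ofReal_le_ofReal ?_)
    · intro x hx t ht
      refine hWs _ x hx q t (ht.trans ?_)
      gcongr
      omega
    · rw [← hcongr _ (multiDeriv_add_single (hW 0) hf (β + γ') q (l - order γ'))]
      refine (eLpNorm_mono_measure _ (Measure.restrict_mono (hmono0 _) le_rfl)).trans
        ((hl _ ?_).trans (ENNReal.ofReal_le_ofReal ?_))
      · rw [order_add, order_add, order_single]
        omega
      · have h1 : T ^ l = T ^ order γ' * T ^ (l - order γ') := by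
          rw [← pow_add]
          congr 1
          omega
        rw [h1, ← mul_assoc]
        gcongr
        · exact le_mul_of_one_le_left hA (one_le_pow₀ (by norm_num))
        · linarith
    · rw [hord]
      apply le_of_eq
      ring

end MultiDeriv

/-! ### Weight sequences and base sequences -/

section Sequences

/-- Since `M₀ = 1`, `Mₖ` is the product of `μ₁, …, μₖ`, none of which exceeds `μₖ₊₁`. -/
lemma IsWeightSequence.le_quot_pow {M : ℕ → ℝ} (hM : IsWeightSequence M) (k : ℕ) :
    M k ≤ (M (k + 1) / M k) ^ k := by
  induction k with
  | zero => simp [hM.zero]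
  | succ k ih =>
    have h0 := hM.pos k
    have h1 := hM.pos (k + 1)
    calc M (k + 1) = M k * (M (k + 1) / M k) := by field_simp
      _ ≤ (M (k + 1) / M k) ^ k * (M (k + 1) / M k) := by gcongr
      _ = (M (k + 1) / M k) ^ (k + 1) := (pow_succ _ _).symm
      _ ≤ _ := pow_le_pow_left₀ (by positivity) (hM.quot_mono k) _

lemma IsWeightSequence.root_pos {M : ℕ → ℝ} (hM : IsWeightSequence M) (k : ℕ) : 0 < root M k :=
  Real.rpow_pos_of_pos (hM.pos k) _

lemma IsWeightSequence.root_pow {M : ℕ → ℝ} (hM : IsWeightSequence M) (k : ℕ) :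
    root M k ^ k = M k := by
  rcases Nat.eq_zero_or_pos k with rfl | hk
  · simp [hM.zero]
  · rw [root, one_div, Real.rpow_inv_natCast_pow (hM.pos k).le hk.ne']

lemma root_zero (M : ℕ → ℝ) : root M 0 = 1 := by
  simp [root]

lemma IsWeightSequence.root_mono {M : ℕ → ℝ} (hM : IsWeightSequence M) : Monotone (root M) := by
  refine monotone_nat_of_le_succ fun k => ?_
  rcases Nat.eq_zero_or_pos k with rfl | hk
  · simpa [root] using hM.one_le
  · refine le_of_pow_le_pow_left₀ (n := k * (k + 1)) (by positivity) (hM.root_pos _).le ?_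
    have h0 := hM.pos k
    have h1 := hM.pos (k + 1)
    calc root M k ^ (k * (k + 1)) = M k ^ k * M k := by
          rw [pow_mul, hM.root_pow, pow_succ]
      _ ≤ M k ^ k * (M (k + 1) / M k) ^ k := by
          gcongr
          exact hM.le_quot_pow k
      _ = M (k + 1) ^ k := by
          rw [← mul_pow]
          congr 1
          field_simp
      _ = root M (k + 1) ^ (k * (k + 1)) := by
          rw [mul_comm k, pow_mul, hM.root_pow]

lemma IsWeightSequence.mul_root_pow {M : ℕ → ℝ} (hM : IsWeightSequence M) (ρ : ℝ) (k : ℕ) :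
    (ρ * root M k) ^ k = ρ ^ k * M k := by
  rw [mul_pow, hM.root_pow]

lemma IsWeightSequence.one_le_root {M : ℕ → ℝ} (hM : IsWeightSequence M) (k : ℕ) :
    1 ≤ root M k := by
  rw [← root_zero M]
  exact hM.root_mono (Nat.zero_le k)

lemma IsBaseSequence.exists_mem_Ico {k : ℕ → ℕ} (hk : IsBaseSequence k) {i j₀ : ℕ}
    (hi : k j₀ ≤ i) : ∃ j, j₀ ≤ j ∧ k j ≤ i ∧ i < k (j + 1) := by
  have hex : ∃ j, i < k (j + 1) := ⟨i, (Nat.lt_succ_self i).trans_le (hk.strictMono.id_le _)⟩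
  classical
  refine ⟨Nat.find hex, ?_, ?_, Nat.find_spec hex⟩
  · by_contra! h
    have h1 := Nat.find_spec hex
    have h2 := hk.strictMono.monotone (show Nat.find hex + 1 ≤ j₀ by omega)
    omega
  · rcases hj : Nat.find hex with _ | j
    · rw [hk.zero]
      exact Nat.zero_le i
    · have := Nat.find_min hex (m := j) (by omega)
      omega

lemma pos_and_le_of_div_le {M M' : ℕ → ℝ} (hM : IsWeightSequence M) (hM' : IsWeightSequence M')
    {k : ℕ → ℕ} {A : ℝ} (h : ∀ j, root M (k (j + 1)) / root M' (k j) ≤ A) :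
    0 < A ∧ ∀ j, root M (k (j + 1)) ≤ A * root M' (k j) :=
  ⟨(div_pos (hM.root_pos _) (hM'.root_pos _)).trans_le (h 0),
    fun j => (div_le_iff₀ (hM'.root_pos _)).1 (h j)⟩

lemma exists_const_of_eventually_le {g h : ℕ → ℝ} (hg : ∀ i, 0 ≤ g i) (hh : ∀ i, 0 < h i)
    (hgh : ∀ᶠ i in atTop, g i ≤ h i) : ∃ C : ℝ, 0 < C ∧ ∀ i, g i ≤ C * h i := by
  obtain ⟨N, hN⟩ := eventually_atTop.1 hgh
  have hnn : ∀ i ∈ Finset.range N, 0 ≤ g i / h i := fun i _ => div_nonneg (hg i) (hh i).le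
  have h0 := Finset.sum_nonneg hnn
  refine ⟨1 + ∑ i ∈ Finset.range N, g i / h i, by positivity, fun i => ?_⟩
  by_cases hi : N ≤ i
  · refine (hN i hi).trans (le_mul_of_one_le_left (hh i).le (by linarith))
  · rw [← div_le_iff₀ (hh i)]
    have := Finset.single_le_sum hnn (Finset.mem_range.2 (not_le.1 hi))
    linarith

end Sequences

/-! ### Derivative bounds along a base sequence -/

section Bounds

variable {n : ℕ} {𝕜 : Type*} [RCLike 𝕜] {p : ℝ≥0∞} {f : EuclideanSpace ℝ (Fin n) → 𝕜}
  {Ω U : Set (EuclideanSpace ℝ (Fin n))} {K : Set ℕ} {M : ℕ → ℝ} {ρ C : ℝ}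

lemma DerivBound.mono_set (h : DerivBound p Ω K M ρ C f) {Ω' : Set (EuclideanSpace ℝ (Fin n))}
    (hΩ : Ω' ⊆ Ω) {K' : Set ℕ} (hK : K' ⊆ K) : DerivBound p Ω' K' M ρ C f := fun α hα =>
  (eLpNorm_mono_measure _ (Measure.restrict_mono hΩ le_rfl)).trans (h α (hK hα))

lemma DerivBound.mono_radius (h : DerivBound p Ω K M ρ C f) (hM : IsWeightSequence M) (hρ : 0 ≤ ρ)
    (hC : 0 ≤ C) {ρ' : ℝ} (hρ' : ρ ≤ ρ') : DerivBound p Ω K M ρ' C f := fun α hα =>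
  (h α hα).trans <| ENNReal.ofReal_le_ofReal <| by
    have := (hM.root_pos (order α)).le
    gcongr

/-- Bounds on the derivatives whose order lies in a base sequence imply bounds on all
derivatives, on a smaller domain. -/
lemma DerivBound.of_lacunary (hp : 1 ≤ p) {W : ℕ → Set (EuclideanSpace ℝ (Fin n))}
    (hW : ∀ q, IsOpen (W q)) (hf : ContDiffOn ℝ ∞ f (W 0)) {k : ℕ → ℕ} (hk : IsBaseSequence k)
    {M₁ M₂ : ℕ → ℝ} (hM₁ : IsWeightSequence M₁) (hM₂ : IsWeightSequence M₂) (hρ : 0 < ρ)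
    (hC : 0 < C) {A : ℝ} (hA : ∀ j, root M₁ (k (j + 1)) ≤ A * root M₂ (k j)) {j₀ : ℕ}
    (hWs : ∀ j, j₀ ≤ j → ∀ q, ∀ x ∈ W (q + 1), ∀ i : Fin n, ∀ t : ℝ,
      |t| ≤ k (j + 1) / (6 * (ρ * root M₁ (k (j + 1)))) →
      x + t • EuclideanSpace.single i (1 : ℝ) ∈ W q)
    (h : DerivBound p (W 0) (Set.range k) M₁ ρ C f) :
    DerivBound p (W n) (Set.Ici (k j₀)) M₂ (12 * A * ρ) (2 ^ n * C) f := by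
  intro α hα
  obtain ⟨j, hj, hj1, hj2⟩ := hk.exists_mem_Ico hα
  obtain ⟨β, γ, rfl, hβ⟩ := exists_le_of_le_order α hj1
  have hk' := hk.strictMono (Nat.lt_succ_self j)
  -- With this `T`, the bound at order `kⱼ₊₁` is exactly `(C T ^ kⱼ) T ^ (kⱼ₊₁ - kⱼ)`, and monotone
  -- roots give `C T ^ kⱼ` at order `kⱼ`.
  set T := ρ * root M₁ (k (j + 1)) with hT
  have hTpos : 0 < T := mul_pos hρ (hM₁.root_pos _)
  rw [order_add] at hj1 hj2 ⊢
  have key := eLpNorm_multiDeriv_add_le hp hW hf (l := k (j + 1) - k j) hTpos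
    (A := C * T ^ k j) (by positivity) (β := β) ?_ ?_ ?_ Finset.univ γ (by simp) (by omega)
  · rw [Finset.card_univ, Fintype.card_fin] at key
    refine key.trans (ENNReal.ofReal_le_ofReal ?_)
    have hTle : T ≤ A * ρ * root M₂ (order β + order γ) := by
      have h1 : root M₂ (k j) ≤ root M₂ (order β + order γ) := hM₂.root_mono hj1
      have hA0 : 0 < A := by
        have := (hM₁.root_pos _).trans_le (hA j)
        exact pos_of_mul_pos_left this (hM₂.root_pos _).le
      calc T ≤ ρ * (A * root M₂ (k j)) := by rw [hT]; gcongr; exact hA j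
        _ ≤ ρ * (A * root M₂ (order β + order γ)) := by gcongr
        _ = _ := by ring
    calc 2 ^ n * (C * T ^ k j) * (12 * T) ^ order γ
        ≤ 2 ^ n * (C * (12 * T) ^ k j) * (12 * T) ^ order γ := by
          gcongr
          linarith
      _ = 2 ^ n * C * (12 * T) ^ (order β + order γ) := by rw [hβ, pow_add]; ring
      _ ≤ _ := by
          refine mul_le_mul_of_nonneg_left (pow_le_pow_left₀ (by positivity) ?_ _) (by positivity)
          linarith
  · intro q x hx i t ht
    refine hWs j hj q x hx i t (ht.trans ?_)
    gcongr
    omega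
  · refine (h β ⟨j, hβ.symm⟩).trans (ENNReal.ofReal_le_ofReal ?_)
    have h1 := hM₁.root_pos (k j)
    rw [hβ]
    gcongr
    rw [hT]
    gcongr
    exact hM₁.root_mono hk'.le
  · intro δ hδ
    have hδ' : order δ = k (j + 1) := by omega
    refine (h δ ⟨j + 1, hδ'.symm⟩).trans (ENNReal.ofReal_le_ofReal ?_)
    rw [hδ', ← hT, mul_assoc, ← pow_add, Nat.add_sub_cancel' hk'.le]

/-- The global case of `DerivBound.of_lacunary`. -/
lemma DerivBound.of_lacunary_univ (hp : 1 ≤ p) (hf : ContDiff ℝ ∞ f) {k : ℕ → ℕ}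
    (hk : IsBaseSequence k) {M₁ M₂ : ℕ → ℝ} (hM₁ : IsWeightSequence M₁)
    (hM₂ : IsWeightSequence M₂) (hρ : 0 < ρ) (hC : 0 < C) {A : ℝ}
    (hA : ∀ j, root M₁ (k (j + 1)) ≤ A * root M₂ (k j))
    (h : DerivBound p Set.univ (Set.range k) M₁ ρ C f) :
    DerivBound p Set.univ Set.univ M₂ (12 * A * ρ) (2 ^ n * C) f := by
  have := DerivBound.of_lacunary hp (W := fun _ => Set.univ) (fun _ => isOpen_univ)
    hf.contDiffOn hk hM₁ hM₂ hρ hC hA (j₀ := 0) (by simp) h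
  rw [hk.zero] at this
  exact this.mono_set subset_rfl (by simp)

/-- Interpolation shrinks the domain once per coordinate. The available room is cut into `n + 1`
layers of width `δ`, so that after `n` shrinkings a neighborhood of `closure Ω` remains. -/
lemma exists_shrinking_neighborhoods (n : ℕ) {Ω U : Set (EuclideanSpace ℝ (Fin n))} (hU : IsOpen U)
    (hΩ : RelCompactIn Ω U) :
    ∃ δ > 0, ∃ W : ℕ → Set (EuclideanSpace ℝ (Fin n)), (∀ q, IsOpen (W q)) ∧
      RelCompactIn (W 0) U ∧ Ω ⊆ W n ∧ ∀ q, ∀ x ∈ W (q + 1), ∀ i : Fin n, ∀ t : ℝ, |t| ≤ δ →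
        x + t • EuclideanSpace.single i (1 : ℝ) ∈ W q := by
  obtain ⟨ε, hε, hεU⟩ := hΩ.2.1.exists_cthickening_subset_open hU hΩ.2.2
  set δ := ε / (n + 1) with hδ
  have hδpos : 0 < δ := by positivity
  refine ⟨δ, hδpos, fun q => Metric.thickening ((n + 1 - q) * δ) (closure Ω),
    fun q => Metric.isOpen_thickening, ?_, ?_, ?_⟩
  · have h1 : closure (Metric.thickening (((n : ℝ) + 1 - (0 : ℕ)) * δ) (closure Ω)) ⊆
        Metric.cthickening ε (closure Ω) := by
      have : ((n : ℝ) + 1 - (0 : ℕ)) * δ = ε := by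
        rw [hδ]
        field_simp
        simp
      rw [this]
      exact Metric.closure_thickening_subset_cthickening _ _
    exact ⟨Metric.isOpen_thickening, hΩ.2.1.cthickening.of_isClosed_subset isClosed_closure h1,
      h1.trans hεU⟩
  · refine subset_closure.trans (Metric.self_subset_thickening ?_ _)
    rw [add_sub_cancel_left]
    positivity
  · intro q x hx i t ht
    obtain ⟨z, hz, hxz⟩ := Metric.mem_thickening_iff.1 hx
    refine Metric.mem_thickening_iff.2 ⟨z, hz, ?_⟩
    calc dist (x + t • EuclideanSpace.single i (1 : ℝ)) z
        ≤ dist (x + t • EuclideanSpace.single i (1 : ℝ)) x + dist x z := dist_triangle _ _ _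
      _ = |t| + dist x z := by simp [norm_smul]
      _ < _ := by push_cast at hxz; linarith

lemma eLpNorm_multiDeriv_lt_top (hU : IsOpen U) (hf : ContDiffOn ℝ ∞ f U) (hΩ : RelCompactIn Ω U)
    (α : Fin n → ℕ) : eLpNorm (multiDeriv α f) p (volume.restrict Ω) < ⊤ := by
  obtain ⟨B, hB⟩ := hΩ.2.1.exists_bound_of_continuousOn
    ((contDiffOn_multiDeriv hU hf α).continuousOn.mono hΩ.2.2)
  have : IsFiniteMeasure (volume.restrict Ω) :=
    ⟨by
      rw [Measure.restrict_apply_univ]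
      exact (measure_mono subset_closure).trans_lt hΩ.2.1.measure_lt_top⟩
  have hb : ∀ᵐ x ∂volume.restrict Ω, ‖multiDeriv α f x‖ ≤ B := by
    filter_upwards [ae_restrict_mem hΩ.1.measurableSet] with x hx using hB x (subset_closure hx)
  refine (MemLp.of_bound ?_ B hb).2
  exact ((contDiffOn_multiDeriv hU hf α).continuousOn.mono
    (subset_closure.trans hΩ.2.2)).aestronglyMeasurable hΩ.1.measurableSet

/-- The bounds on finitely many derivatives are automatic. -/
lemma DerivBound.exists_of_Ici (hU : IsOpen U) (hf : ContDiffOn ℝ ∞ f U) (hΩ : RelCompactIn Ω U)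
    (hM : IsWeightSequence M) (hρ : 0 < ρ) (hC : 0 < C) {N : ℕ}
    (h : DerivBound p Ω (Set.Ici N) M ρ C f) : ∃ C' > 0, DerivBound p Ω Set.univ M ρ C' f := by
  have hfin : {α : Fin n → ℕ | order α < N}.Finite := by
    refine (Set.finite_Iic (fun _ => N : Fin n → ℕ)).subset fun α hα i => ?_
    have h1 : α i ≤ order α := Finset.single_le_sum (fun _ _ => Nat.zero_le _) (Finset.mem_univ i)
    exact h1.trans (le_of_lt hα)
  set b : (Fin n → ℕ) → ℝ := fun α =>
    (eLpNorm (multiDeriv α f) p (volume.restrict Ω)).toReal / (ρ * root M (order α)) ^ order α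
    with hb
  have hpos : ∀ α : Fin n → ℕ, 0 < (ρ * root M (order α)) ^ order α := fun α =>
    pow_pos (mul_pos hρ (hM.root_pos _)) _
  have hb0 : ∀ α ∈ hfin.toFinset, 0 ≤ b α := fun α _ =>
    div_nonneg ENNReal.toReal_nonneg (hpos α).le
  have hs := Finset.sum_nonneg hb0
  refine ⟨C + ∑ α ∈ hfin.toFinset, b α, by positivity, fun α _ => ?_⟩
  by_cases hα : N ≤ order α
  · refine (h α hα).trans (ENNReal.ofReal_le_ofReal ?_)
    have := hpos α
    gcongr
    linarith
  · rw [← ENNReal.ofReal_toReal (eLpNorm_multiDeriv_lt_top (p := p) hU hf hΩ α).ne]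
    refine ENNReal.ofReal_le_ofReal ?_
    have h1 := Finset.single_le_sum hb0 (hfin.mem_toFinset.2 (not_le.1 hα))
    rw [← div_le_iff₀ (hpos α)]
    exact h1.trans (by linarith)

end Bounds

/-! ### Equality of the classes defined by derivative bounds -/

section Classes

variable {n : ℕ} {𝕜 : Type*} [RCLike 𝕜] {p : ℝ≥0∞} {𝔐 : Set (ℕ → ℝ)} {k : ℕ → ℕ}

lemma bRoumieu_eq (hp : 1 ≤ p) (hk : IsBaseSequence k) (h𝔐 : IsWeightFamily 𝔐)
    (hR : RoumieuMixed 𝔐 k) :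
    BRoumieu n 𝕜 𝔐 p (Set.range k) = BRoumieu n 𝕜 𝔐 p Set.univ := by
  ext f
  constructor
  · rintro ⟨hf, M, hM, ρ, hρ, C, hC, h⟩
    obtain ⟨M', hM', A, hA⟩ := hR M hM
    obtain ⟨hA0, hA⟩ := pos_and_le_of_div_le (h𝔐.weight M hM) (h𝔐.weight M' hM') hA
    exact ⟨hf, M', hM', _, by positivity, _, by positivity,
      h.of_lacunary_univ hp hf hk (h𝔐.weight M hM) (h𝔐.weight M' hM') hρ hC hA⟩
  · rintro ⟨hf, M, hM, ρ, hρ, C, hC, h⟩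
    exact ⟨hf, M, hM, ρ, hρ, C, hC, h.mono_set subset_rfl (Set.subset_univ _)⟩

lemma bBeurling_eq (hp : 1 ≤ p) (hk : IsBaseSequence k) (h𝔐 : IsWeightFamily 𝔐)
    (hB : BeurlingMixed 𝔐 k) :
    BBeurling n 𝕜 𝔐 p (Set.range k) = BBeurling n 𝕜 𝔐 p Set.univ := by
  ext f
  constructor
  · rintro ⟨hf, h⟩
    refine ⟨hf, fun M hM ρ hρ => ?_⟩
    obtain ⟨M', hM', A, hA⟩ := hB M hM
    obtain ⟨hA0, hA⟩ := pos_and_le_of_div_le (h𝔐.weight M' hM') (h𝔐.weight M hM) hA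
    -- Interpolation multiplies the radius by `12 A`; this choice returns exactly `ρ`.
    obtain ⟨C, hC, hb⟩ := h M' hM' (ρ / (12 * A)) (by positivity)
    have := hb.of_lacunary_univ hp hf hk (h𝔐.weight M' hM') (h𝔐.weight M hM) (by positivity) hC hA
    rw [mul_div_cancel₀ _ (by positivity)] at this
    exact ⟨_, by positivity, this⟩
  · rintro ⟨hf, h⟩
    refine ⟨hf, fun M hM ρ hρ => ?_⟩
    obtain ⟨C, hC, hb⟩ := h M hM ρ hρ
    exact ⟨C, hC, hb.mono_set subset_rfl (Set.subset_univ _)⟩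

lemma eRoumieu_eq (hp : 1 ≤ p) (hk : IsBaseSequence k) (h𝔐 : IsWeightFamily 𝔐)
    (hR : RoumieuMixed 𝔐 k) (hb : ∀ M ∈ 𝔐, ∃ A : ℝ, ∀ j : ℕ, (j : ℝ) / root M j ≤ A)
    {U : Set (EuclideanSpace ℝ (Fin n))} (hU : IsOpen U) :
    ERoumieu 𝕜 𝔐 p U (Set.range k) = ERoumieu 𝕜 𝔐 p U Set.univ := by
  ext f
  constructor
  · rintro ⟨hf, h⟩
    refine ⟨hf, fun Ω hΩ => ?_⟩
    obtain ⟨δ, hδ, W, hWo, hW0, hWn, hWs⟩ := exists_shrinking_neighborhoods n hU hΩ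
    obtain ⟨M, hM, ρ, hρ, C, hC, h⟩ := h _ hW0
    obtain ⟨M', hM', A, hA⟩ := hR M hM
    obtain ⟨hA0, hA⟩ := pos_and_le_of_div_le (h𝔐.weight M hM) (h𝔐.weight M' hM') hA
    obtain ⟨B, hB⟩ := hb M hM
    have hMw := h𝔐.weight M hM
    -- Enlarging the radius to at least `B / (6 δ)` keeps every displacement `k / (6 ρ' mₖ)` within
    -- `δ`.
    set ρ' := max ρ (B / (6 * δ)) with hρ'
    have hρ'0 : 0 < ρ' := hρ.trans_le (le_max_left _ _)
    refine ⟨M', hM', 12 * A * ρ', by positivity, 2 ^ n * C, by positivity, ?_⟩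
    have := (h.mono_radius hMw hρ.le hC.le (le_max_left _ _)).of_lacunary hp hWo
      (hf.mono (subset_closure.trans hW0.2.2)) hk hMw (h𝔐.weight M' hM') hρ'0 hC hA (j₀ := 0) ?_
    · exact this.mono_set hWn (by simp [hk.zero])
    · intro j _ q x hx i t ht
      refine hWs q x hx i t (ht.trans ?_)
      have h1 := hB (k (j + 1))
      have h2 := hMw.root_pos (k (j + 1))
      have h3 : B / (6 * δ) ≤ ρ' := le_max_right _ _
      rw [div_le_iff₀ h2] at h1
      rw [div_le_iff₀ (by positivity)] at h3 ⊢
      calc _ ≤ _ := h1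
        _ ≤ ρ' * (6 * δ) * root M (k (j + 1)) := by gcongr
        _ = _ := by ring
  · rintro ⟨hf, h⟩
    refine ⟨hf, fun Ω hΩ => ?_⟩
    obtain ⟨M, hM, ρ, hρ, C, hC, h⟩ := h Ω hΩ
    exact ⟨M, hM, ρ, hρ, C, hC, h.mono_set subset_rfl (Set.subset_univ _)⟩

lemma eBeurling_eq (hp : 1 ≤ p) (hk : IsBaseSequence k) (h𝔐 : IsWeightFamily 𝔐)
    (hR : BeurlingMixed 𝔐 k)
    (hb : ∀ M ∈ 𝔐, Tendsto (fun j : ℕ => (j : ℝ) / root M j) atTop (𝓝 0))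
    {U : Set (EuclideanSpace ℝ (Fin n))} (hU : IsOpen U) :
    EBeurling 𝕜 𝔐 p U (Set.range k) = EBeurling 𝕜 𝔐 p U Set.univ := by
  ext f
  constructor
  · rintro ⟨hf, h⟩
    refine ⟨hf, fun Ω hΩ M hM ρ hρ => ?_⟩
    obtain ⟨δ, hδ, W, hWo, hW0, hWn, hWs⟩ := exists_shrinking_neighborhoods n hU hΩ
    obtain ⟨M', hM', A, hA⟩ := hR M hM
    have hMw := h𝔐.weight M' hM'
    obtain ⟨hA0, hA⟩ := pos_and_le_of_div_le hMw (h𝔐.weight M hM) hA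
    have hρ'0 : 0 < ρ / (12 * A) := by positivity
    obtain ⟨C, hC, h⟩ := h _ hW0 M' hM' (ρ / (12 * A)) hρ'0
    -- The radius is prescribed here, so displacements are within `δ` only from some order on; the
    -- finitely many lower derivatives are bounded on the relatively compact `Ω`.
    obtain ⟨j₀, hj₀⟩ := eventually_atTop.1 ((hb M' hM').eventually_le_const
      (show 0 < 6 * (ρ / (12 * A)) * δ by positivity))
    have := h.of_lacunary hp hWo (hf.mono (subset_closure.trans hW0.2.2)) hk hMw
      (h𝔐.weight M hM) hρ'0 hC hA (j₀ := j₀) ?_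
    · rw [mul_div_cancel₀ _ (by positivity)] at this
      exact (this.mono_set hWn subset_rfl).exists_of_Ici hU hf hΩ (h𝔐.weight M hM) hρ
        (by positivity)
    · intro j hj q x hx i t ht
      refine hWs q x hx i t (ht.trans ?_)
      have h1 := hj₀ (k (j + 1)) (hj.trans ((Nat.le_succ j).trans (hk.strictMono.id_le _)))
      have h2 := hMw.root_pos (k (j + 1))
      rw [div_le_iff₀ h2] at h1
      rw [div_le_iff₀ (by positivity)]
      calc _ ≤ _ := h1
        _ = _ := by ring
  · rintro ⟨hf, h⟩
    refine ⟨hf, fun Ω hΩ M hM ρ hρ => ?_⟩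
    obtain ⟨C, hC, hb⟩ := h Ω hΩ M hM ρ hρ
    exact ⟨C, hC, hb.mono_set subset_rfl (Set.subset_univ _)⟩

end Classes

/-! ### Gelfand-Shilov classes -/

section GelfandShilov

variable {n : ℕ} {𝕜 : Type*} [RCLike 𝕜] {f g : EuclideanSpace ℝ (Fin n) → 𝕜}

lemma eLpNorm_top_le_of_norm_le {W : Set (EuclideanSpace ℝ (Fin n))} (hW : MeasurableSet W)
    {B : ℝ} (h : ∀ x ∈ W, ‖g x‖ ≤ B) : eLpNorm g ⊤ (volume.restrict W) ≤ ENNReal.ofReal B := by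
  rw [eLpNorm_exponent_top]
  refine eLpNormEssSup_le_of_ae_bound ?_
  filter_upwards [ae_restrict_mem hW] with x hx using h x hx

lemma norm_le_of_eLpNorm_top_le {W : Set (EuclideanSpace ℝ (Fin n))} (hW : IsOpen W)
    (hg : ContinuousOn g W) {B : ℝ} (hB : 0 ≤ B)
    (h : eLpNorm g ⊤ (volume.restrict W) ≤ ENNReal.ofReal B) {x : EuclideanSpace ℝ (Fin n)}
    (hx : x ∈ W) : ‖g x‖ ≤ B := by
  by_contra! hlt
  have hopen : IsOpen (W ∩ {y | B < ‖g y‖}) :=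
    hg.norm.isOpen_inter_preimage hW isOpen_Ioi
  have hpos : 0 < volume (W ∩ {y | B < ‖g y‖}) := hopen.measure_pos volume ⟨x, hx, hlt⟩
  rw [eLpNorm_exponent_top] at h
  have hae : ∀ᵐ y ∂volume.restrict W, ‖g y‖ ≤ B := by
    filter_upwards [ae_le_eLpNormEssSup (f := g) (μ := volume.restrict W)] with y hy
    have := hy.trans h
    rwa [← ofReal_norm, ENNReal.ofReal_le_ofReal_iff hB] at this
  rw [ae_restrict_iff' hW.measurableSet] at hae
  refine hpos.ne' (measure_mono_null (fun y hy => ?_) hae)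
  simpa using hy

lemma abs_coord_le (x : EuclideanSpace ℝ (Fin n)) (i : Fin n) : |x i| ≤ ‖WithLp.ofLp x‖ :=
  norm_le_pi_norm (WithLp.ofLp x) i

lemma abs_monom_le (α : Fin n → ℕ) (x : EuclideanSpace ℝ (Fin n)) :
    |monom α x| ≤ ‖WithLp.ofLp x‖ ^ order α := by
  rw [monom, Finset.abs_prod, order, ← Finset.prod_pow_eq_pow_sum]
  refine Finset.prod_le_prod (fun _ _ => abs_nonneg _) fun i _ => ?_
  rw [abs_pow]
  exact pow_le_pow_left₀ (abs_nonneg _) (abs_coord_le x i) _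

/-- `WithLp.ofLp x` carries the sup norm, whose `k`-th power is the monomial in a coordinate of
largest modulus. Hence no constant is lost. -/
lemma norm_pow_mul_le {x : EuclideanSpace ℝ (Fin n)} {k : ℕ} {G B : ℝ} (hB : 0 ≤ B)
    (h : ∀ α : Fin n → ℕ, order α = k → |monom α x| * G ≤ B) :
    ‖WithLp.ofLp x‖ ^ k * G ≤ B := by
  rcases Nat.eq_zero_or_pos k with rfl | hk
  · simpa [monom] using h 0 order_zero
  rcases isEmpty_or_nonempty (Fin n) with hn | hn
  · have : ‖WithLp.ofLp x‖ = 0 := by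
      rw [norm_eq_zero]
      exact Subsingleton.elim _ _
    simpa [this, hk.ne'] using hB
  · obtain ⟨i, hi⟩ := Finite.exists_max fun i => |x i|
    have h1 : ‖WithLp.ofLp x‖ = |x i| :=
      le_antisymm ((pi_norm_le_iff_of_nonneg (abs_nonneg _)).2 hi) (abs_coord_le x i)
    have h2 : monom (Pi.single i k) x = x i ^ k := by
      rw [monom, Finset.prod_eq_single i]
      · simp
      · intro j _ hj
        simp [hj]
      · simp
    have h3 := h (Pi.single i k) (order_single i k)
    rwa [h2, abs_pow, ← h1] at h3

/-- Between `kⱼ` and `kⱼ₊₁` the threshold is `T = ρ m_{kⱼ₊₁}`: for `y ≤ T` the bound at `kⱼ` is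
multiplied by powers of `y`, for `y > T` the bound at `kⱼ₊₁` is divided by them. -/
lemma pow_mul_le_of_lacunary {k : ℕ → ℕ} (hk : IsBaseSequence k) {M₁ M₂ : ℕ → ℝ}
    (hM₁ : IsWeightSequence M₁) (hM₂ : IsWeightSequence M₂) {ρ C A G y : ℝ} (hρ : 0 < ρ)
    (hC : 0 < C) (hA0 : 0 < A) (hA : ∀ j, root M₁ (k (j + 1)) ≤ A * root M₂ (k j)) (hG : 0 ≤ G)
    (hy : 0 ≤ y) (h : ∀ j, y ^ k j * G ≤ C * (ρ * root M₁ (k j)) ^ k j) (i : ℕ) :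
    y ^ i * G ≤ C * ((A * ρ) ^ i * M₂ i) := by
  obtain ⟨j, -, hj1, hj2⟩ := hk.exists_mem_Ico (i := i) (j₀ := 0) (by simp [hk.zero])
  have hk' := hk.strictMono (Nat.lt_succ_self j)
  set T := ρ * root M₁ (k (j + 1)) with hT
  have hTpos : 0 < T := mul_pos hρ (hM₁.root_pos _)
  have hTle : T ≤ A * ρ * root M₂ i := by
    calc T ≤ ρ * (A * root M₂ (k j)) := by rw [hT]; gcongr; exact hA j
      _ ≤ ρ * (A * root M₂ i) := by
          gcongr
          exact hM₂.root_mono hj1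
      _ = _ := by ring
  rw [← hM₂.mul_root_pow]
  refine le_trans ?_ (mul_le_mul_of_nonneg_left (pow_le_pow_left₀ hTpos.le hTle i) hC.le)
  rcases le_or_gt y T with hyT | hyT
  · have h1 : ρ * root M₁ (k j) ≤ T := by
      rw [hT]
      gcongr
      exact hM₁.root_mono hk'.le
    have h2 := hM₁.root_pos (k j)
    calc y ^ i * G = y ^ (i - k j) * (y ^ k j * G) := by
          rw [← mul_assoc, ← pow_add, Nat.sub_add_cancel hj1]
      _ ≤ T ^ (i - k j) * (C * T ^ k j) := by
          refine mul_le_mul (pow_le_pow_left₀ hy hyT _) ((h j).trans ?_) (by positivity)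
            (by positivity)
          gcongr
      _ = C * T ^ i := by
          rw [mul_left_comm, ← pow_add, Nat.sub_add_cancel hj1]
  · have h1 := h (j + 1)
    rw [← hT] at h1
    have h2 : T ^ (k (j + 1) - i) * (y ^ i * G) ≤ T ^ (k (j + 1) - i) * (C * T ^ i) := by
      calc _ ≤ y ^ (k (j + 1) - i) * (y ^ i * G) := by gcongr
        _ = y ^ k (j + 1) * G := by rw [← mul_assoc, ← pow_add, Nat.sub_add_cancel hj2.le]
        _ ≤ _ := h1
        _ = _ := by rw [mul_left_comm, ← pow_add, Nat.sub_add_cancel hj2.le]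
    exact le_of_mul_le_mul_left h2 (by positivity)

lemma LacunaryGSBound.pow_mul_norm_le {k l : ℕ → ℕ} {M₁ M₂ : ℕ → ℝ} {ρ σ C A : ℝ}
    (h : LacunaryGSBound k l M₁ ρ σ C f) (hk : IsBaseSequence k) (hM₁ : IsWeightSequence M₁)
    (hM₂ : IsWeightSequence M₂) (hρ : 0 < ρ) (hC : 0 < C) (hA0 : 0 < A)
    (hA : ∀ j, root M₁ (k (j + 1)) ≤ A * root M₂ (k j)) (x : EuclideanSpace ℝ (Fin n)) (i : ℕ) :
    ‖WithLp.ofLp x‖ ^ i * ‖f x‖ ≤ C * ((A * ρ) ^ i * M₂ i) := by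
  refine pow_mul_le_of_lacunary hk hM₁ hM₂ hρ hC hA0 hA (norm_nonneg _) (norm_nonneg _)
    (fun j => norm_pow_mul_le ?_ fun α hα => h.1 j α hα x) i
  have := hM₁.root_pos (k j)
  positivity

lemma LacunaryGSBound.norm_multiDeriv_le {k l : ℕ → ℕ} {M₁ M₂ : ℕ → ℝ} {ρ σ C A : ℝ}
    (h : LacunaryGSBound k l M₁ ρ σ C f) (hf : ContDiff ℝ ∞ f) (hl : IsBaseSequence l)
    (hM₁ : IsWeightSequence M₁) (hM₂ : IsWeightSequence M₂) (hσ : 0 < σ) (hC : 0 < C)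
    (hA0 : 0 < A) (hA : ∀ j, root M₁ (l (j + 1)) ≤ A * root M₂ (l j)) (β : Fin n → ℕ)
    (x : EuclideanSpace ℝ (Fin n)) :
    ‖multiDeriv β f x‖ ≤ 2 ^ n * C * ((12 * A * σ) ^ order β * M₂ (order β)) := by
  have hb : DerivBound ⊤ Set.univ (Set.range l) M₁ σ C f := by
    rintro α ⟨j, hj⟩
    refine eLpNorm_top_le_of_norm_le MeasurableSet.univ fun x _ => ?_
    rw [← hj]
    exact h.2 j α hj.symm x
  have := hb.of_lacunary_univ le_top hf hl hM₁ hM₂ hσ hC hA β (Set.mem_univ _)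
  rw [hM₂.mul_root_pow] at this
  have h1 := hM₂.pos (order β)
  exact norm_le_of_eLpNorm_top_le isOpen_univ
    (contDiffOn_multiDeriv isOpen_univ hf.contDiffOn β).continuousOn (by positivity) this
    (Set.mem_univ x)

/-- Pointwise interpolation between `f` and its derivatives of order `2 s` on the unit ball. -/
lemma norm_multiDeriv_le_of_ball (hf : ContDiff ℝ ∞ f) {x : EuclideanSpace ℝ (Fin n)}
    {β : Fin n → ℕ} (hβ : 0 < order β) {A T : ℝ} (hA : 0 ≤ A) (hT : 0 < T)
    (hT' : (n + 1) * order β ≤ T) (h0 : ∀ z ∈ Metric.ball x 1, ‖f z‖ ≤ A)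
    (h1 : ∀ γ : Fin n → ℕ, order γ = 2 * order β → ∀ z, ‖multiDeriv γ f z‖ ≤
      A * T ^ (2 * order β)) :
    ‖multiDeriv β f x‖ ≤ 2 ^ n * A * (12 * T) ^ order β := by
  -- The lower bound on `T` makes every displacement at most `1 / (n + 1)`, so `x` still lies in the
  -- ball left after `n` shrinkings.
  set W : ℕ → Set (EuclideanSpace ℝ (Fin n)) := fun q => Metric.ball x ((n + 1 - q) * (1 / (n + 1)))
    with hW
  have hW0 : W 0 = Metric.ball x 1 := by
    simp only [hW]
    congr 1
    field_simp
    simp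
  have key := eLpNorm_multiDeriv_add_le (p := ⊤) le_top (W := W) (fun q => Metric.isOpen_ball)
    hf.contDiffOn (l := 2 * order β) hT hA ?_ (β := 0) ?_ ?_ Finset.univ β (by simp) (by omega)
  · rw [Finset.card_univ, Fintype.card_fin, zero_add] at key
    refine norm_le_of_eLpNorm_top_le Metric.isOpen_ball
      ((contDiffOn_multiDeriv isOpen_univ hf.contDiffOn β).continuousOn.mono (Set.subset_univ _))
      (by positivity) key ?_
    simp
    positivity
  · intro q z hz i t ht
    have ht' : |t| ≤ 1 / (n + 1) := by
      refine ht.trans ?_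
      rw [div_le_div_iff₀ (by positivity) (by positivity)]
      push_cast
      nlinarith
    simp only [hW, Metric.mem_ball] at hz ⊢
    calc dist (z + t • EuclideanSpace.single i (1 : ℝ)) x
        ≤ dist (z + t • EuclideanSpace.single i (1 : ℝ)) z + dist z x := dist_triangle _ _ _
      _ = |t| + dist z x := by simp [norm_smul]
      _ < _ := by push_cast at hz; linarith
  · rw [multiDeriv_zero, hW0]
    exact eLpNorm_top_le_of_norm_le measurableSet_ball h0
  · intro γ hγ
    rw [order_zero, zero_add] at hγ
    exact eLpNorm_top_le_of_norm_le Metric.isOpen_ball.measurableSet fun z _ => h1 γ hγ z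

/-- Separate bounds on the decay of `f` and on the growth of its derivatives imply joint bounds. -/
lemma norm_pow_mul_multiDeriv_le (hf : ContDiff ℝ ∞ f) {M₁ M₂ : ℕ → ℝ}
    (hM₁ : IsWeightSequence M₁) (hM₂ : IsWeightSequence M₂) {H ρ σ C C₃ C₄ : ℝ} (hH : 0 < H)
    (hMG : ∀ j k : ℕ, M₁ (j + k) ≤ H ^ (j + k) * M₂ j * M₂ k) (hρ : 0 < ρ) (hσ : 0 < σ)
    (hC : 0 < C) (hC₃ : 0 < C₃) (hC₄ : 0 < C₄)
    (hP : ∀ (x : EuclideanSpace ℝ (Fin n)) (i : ℕ),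
      ‖WithLp.ofLp x‖ ^ i * ‖f x‖ ≤ C * (ρ ^ i * M₁ i))
    (hQ : ∀ (β : Fin n → ℕ) (x : EuclideanSpace ℝ (Fin n)),
      ‖multiDeriv β f x‖ ≤ C * (σ ^ order β * M₁ (order β)))
    (h₃ : ∀ i, 1 ≤ C₃ * (ρ ^ i * M₁ i))
    (h₄ : ∀ s : ℕ, ((n + 1) * s : ℝ) ^ s ≤ C₄ * ((σ * H) ^ s * M₂ s))
    (β : Fin n → ℕ) (x : EuclideanSpace ℝ (Fin n)) (i : ℕ) :
    ‖WithLp.ofLp x‖ ^ i * ‖multiDeriv β f x‖ ≤ 2 ^ n * (C * (1 + C₃)) * (1 + C₄) *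
      (((2 * ρ * H) ^ i * M₂ i) * ((24 * σ * H) ^ order β * M₂ (order β))) := by
  have hM1 : ∀ j, M₁ j ≤ H ^ j * M₂ j := by
    intro j
    simpa [hM₂.zero] using hMG j 0
  have h2n : (1 : ℝ) ≤ 2 ^ n := one_le_pow₀ (by norm_num)
  set s := order β with hs
  set X := (2 * ρ * H) ^ i * M₂ i with hX
  set Z := (σ * H) ^ s * M₂ s with hZ
  have hXpos : 0 < X := mul_pos (by positivity) (hM₂.pos _)
  have hZpos : 0 < Z := mul_pos (by positivity) (hM₂.pos _)
  have h24 : (24 * σ * H) ^ s * M₂ s = 24 ^ s * Z := by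
    rw [hZ, mul_assoc, mul_pow 24]
    ring
  rw [h24]
  set C₀ := C * (1 + C₃) with hC₀
  have hC₀C : C ≤ C₀ := le_mul_of_one_le_right hC.le (by linarith)
  have hC₀pos : 0 < C₀ := hC.trans_le hC₀C
  -- The easy cases, `s = 0` and `Y ^ i ≤ X`, need no interpolation and end in this bound.
  have hbig : C * (X * Z) ≤ 2 ^ n * C₀ * (1 + C₄) * (X * (24 ^ s * Z)) := by
    calc C * (X * Z) = 1 * C * 1 * (X * (1 * Z)) := by ring
      _ ≤ 2 ^ n * C₀ * (1 + C₄) * (X * (24 ^ s * Z)) := by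
          gcongr
          · linarith
          · exact one_le_pow₀ (by norm_num)
  have hρM : ∀ j, ρ ^ j * M₁ j ≤ (2 * ρ * H) ^ j * M₂ j := by
    intro j
    have h1 := hM₂.pos j
    calc ρ ^ j * M₁ j ≤ ρ ^ j * (H ^ j * M₂ j) := by gcongr; exact hM1 j
      _ = (ρ * H) ^ j * M₂ j := by rw [mul_pow]; ring
      _ ≤ _ := by
          gcongr
          linarith
  rcases Nat.eq_zero_or_pos s with hs0 | hs0
  · have hβ : β = 0 := by
      ext j
      exact Finset.sum_eq_zero_iff.1 (hs.symm.trans hs0) j (Finset.mem_univ j)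
    refine le_trans ?_ hbig
    have hZ1 : Z = 1 := by simp [hZ, hs0, hM₂.zero]
    rw [hZ1, mul_one, hβ, multiDeriv_zero]
    refine (hP x i).trans ?_
    gcongr
    exact hρM i
  set Y := max 1 ‖WithLp.ofLp x‖ with hY
  have hY1 : 1 ≤ Y := le_max_left _ _
  have hYx : ‖WithLp.ofLp x‖ ^ i ≤ Y ^ i := pow_le_pow_left₀ (norm_nonneg _) (le_max_right _ _) _
  refine (mul_le_mul_of_nonneg_right hYx (norm_nonneg _)).trans ?_
  rcases le_or_gt (Y ^ i) X with hYX | hYX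
  · refine le_trans ?_ hbig
    calc Y ^ i * ‖multiDeriv β f x‖ ≤ X * (C * Z) := by
          gcongr
          refine (hQ β x).trans ?_
          have h1 := hM₂.pos s
          calc _ ≤ C * (σ ^ s * (H ^ s * M₂ s)) := by gcongr; exact hM1 s
            _ = C * Z := by rw [hZ, mul_pow]; ring
      _ = _ := by ring
  -- Far from the origin `u < 1` measures the decay: near `x`, `f` is of size `u ^ 2`, while
  -- derivatives of order `2 s` are of size `Z ^ 2 = u ^ 2 (Z / u) ^ 2`. Thus `T₁ ^ s = Z / u`
  -- balances the two, and `T₂` is added to keep the interpolation inside the unit ball.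
  set u := X / Y ^ i with hu
  have hYpos : 0 < Y ^ i := by positivity
  have hupos : 0 < u := by positivity
  have hu1 : u ≤ 1 := (div_le_one hYpos).2 hYX.le
  have hYu : Y ^ i * u = X := mul_div_cancel₀ _ hYpos.ne'
  set T₁ := (Z / u) ^ (1 / (s : ℝ)) with hT₁
  have hT₁pos : 0 < T₁ := Real.rpow_pos_of_pos (by positivity) _
  have hT₁s : T₁ ^ s = Z / u := by
    rw [hT₁, one_div, Real.rpow_inv_natCast_pow (by positivity) hs0.ne']
  set T₂ : ℝ := (n + 1) * s with hT₂
  have hT₂pos : 0 < T₂ := by positivity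
  have hball : ∀ z ∈ Metric.ball x 1, ‖f z‖ ≤ C₀ * u ^ 2 := by
    intro z hz
    -- On the unit ball the weight changes by at most a factor `2`; this is the `2` in the radius `2
    -- * ρ * H`.
    have hyz : Y ≤ 2 * max 1 ‖WithLp.ofLp z‖ := by
      have h1 : ‖WithLp.ofLp x‖ ≤ ‖WithLp.ofLp z‖ + 1 := by
        refine (pi_norm_le_iff_of_nonneg (by positivity)).2 fun j => ?_
        have h2 : |x j - z j| ≤ 1 := by
          have h3 : ‖(x - z) j‖ ≤ ‖x - z‖ := PiLp.norm_apply_le _ _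
          rw [Metric.mem_ball, dist_comm, dist_eq_norm] at hz
          exact h3.trans hz.le
        have h3 := abs_coord_le z j
        calc |x j| = |(x j - z j) + z j| := by ring_nf
          _ ≤ |x j - z j| + |z j| := abs_add_le _ _
          _ ≤ _ := by linarith
      have h2 := le_max_left 1 ‖WithLp.ofLp z‖
      have h3 := le_max_right 1 ‖WithLp.ofLp z‖
      exact max_le (by linarith) (by linarith)
    have hmax : max 1 ‖WithLp.ofLp z‖ ^ (2 * i) * ‖f z‖ ≤ C₀ * (ρ ^ (2 * i) * M₁ (2 * i)) := by
      have hm1 := hM₁.pos (2 * i)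
      rcases max_cases 1 ‖WithLp.ofLp z‖ with ⟨h, -⟩ | ⟨h, -⟩
      · rw [h, one_pow, one_mul]
        have h1 := hP z 0
        simp only [pow_zero, one_mul, hM₁.zero, mul_one] at h1
        calc ‖f z‖ ≤ C * 1 := by linarith
          _ ≤ C * (C₃ * (ρ ^ (2 * i) * M₁ (2 * i))) := by gcongr; exact h₃ _
          _ = C * C₃ * (ρ ^ (2 * i) * M₁ (2 * i)) := by ring
          _ ≤ _ := by
              gcongr
              rw [hC₀]
              gcongr
              linarith
      · rw [h]
        refine (hP z (2 * i)).trans ?_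
        gcongr
    have hX2 : 2 ^ (2 * i) * (ρ ^ (2 * i) * M₁ (2 * i)) ≤ X ^ 2 := by
      have h1 := hMG i i
      rw [← two_mul] at h1
      calc _ ≤ 2 ^ (2 * i) * (ρ ^ (2 * i) * (H ^ (2 * i) * M₂ i * M₂ i)) := by gcongr
        _ = X ^ 2 := by
          rw [hX]
          ring
    have h5 : Y ^ (2 * i) * ‖f z‖ ≤ C₀ * X ^ 2 := by
      calc _ ≤ (2 * max 1 ‖WithLp.ofLp z‖) ^ (2 * i) * ‖f z‖ := by gcongr
        _ = 2 ^ (2 * i) * (max 1 ‖WithLp.ofLp z‖ ^ (2 * i) * ‖f z‖) := by rw [mul_pow]; ring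
        _ ≤ 2 ^ (2 * i) * (C₀ * (ρ ^ (2 * i) * M₁ (2 * i))) := by gcongr
        _ = C₀ * (2 ^ (2 * i) * (ρ ^ (2 * i) * M₁ (2 * i))) := by ring
        _ ≤ _ := by gcongr
    rw [hu, div_pow, ← mul_div_assoc, le_div_iff₀ (by positivity), ← pow_mul, mul_comm i 2, mul_comm]
    exact h5
  have hderiv : ∀ γ : Fin n → ℕ, order γ = 2 * order β → ∀ z, ‖multiDeriv γ f z‖ ≤
      C₀ * u ^ 2 * (T₁ + T₂) ^ (2 * order β) := by
    intro γ hγ z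
    rw [← hs] at hγ ⊢
    have h1 := hMG s s
    rw [← two_mul] at h1
    calc _ ≤ C * (σ ^ (2 * s) * M₁ (2 * s)) := by rw [← hγ]; exact hQ γ z
      _ ≤ C₀ * (σ ^ (2 * s) * (H ^ (2 * s) * M₂ s * M₂ s)) := by
          have := hM₁.pos (2 * s)
          gcongr
      _ = C₀ * Z ^ 2 := by rw [hZ]; ring
      _ = C₀ * u ^ 2 * T₁ ^ (2 * s) := by
          rw [mul_comm 2 s, pow_mul, hT₁s]
          field_simp
      _ ≤ _ := by
          gcongr
          linarith
  have key := norm_multiDeriv_le_of_ball hf (x := x) (β := β) hs0 (A := C₀ * u ^ 2)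
    (T := T₁ + T₂) (by positivity) (by positivity) (by rw [← hs, ← hT₂]; linarith) hball hderiv
  rw [← hs] at key
  have hsum : (T₁ + T₂) ^ s ≤ 2 ^ s * (T₁ ^ s + T₂ ^ s) := by
    rcases le_total T₁ T₂ with h | h
    · calc (T₁ + T₂) ^ s ≤ (2 * T₂) ^ s := by gcongr; linarith
        _ = 2 ^ s * (0 + T₂ ^ s) := by rw [mul_pow, zero_add]
        _ ≤ _ := by gcongr; positivity
    · calc (T₁ + T₂) ^ s ≤ (2 * T₁) ^ s := by gcongr; linarith
        _ = 2 ^ s * (T₁ ^ s + 0) := by rw [mul_pow, add_zero]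
        _ ≤ _ := by gcongr; positivity
  -- One factor `u` turns `Y ^ i` into `X`; the other cancels the denominator of `T₁ ^ s` and is
  -- estimated by `1` against `T₂ ^ s`.
  calc Y ^ i * ‖multiDeriv β f x‖ ≤ Y ^ i * (2 ^ n * (C₀ * u ^ 2) * (12 * (T₁ + T₂)) ^ s) := by
        gcongr
    _ = (Y ^ i * u) * 2 ^ n * C₀ * u * 12 ^ s * (T₁ + T₂) ^ s := by rw [mul_pow]; ring
    _ ≤ (Y ^ i * u) * 2 ^ n * C₀ * u * 12 ^ s * (2 ^ s * (T₁ ^ s + T₂ ^ s)) := by gcongr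
    _ = X * 2 ^ n * C₀ * 24 ^ s * (u * T₁ ^ s + u * T₂ ^ s) := by
        rw [hYu, show (24 : ℝ) ^ s = 12 ^ s * 2 ^ s by rw [← mul_pow]; norm_num]
        ring
    _ ≤ X * 2 ^ n * C₀ * 24 ^ s * (Z + 1 * (C₄ * Z)) := by
        gcongr
        · rw [hT₁s, mul_div_cancel₀ _ hupos.ne']
        · exact h₄ s
    _ = _ := by ring

lemma GSBound.lacunary {M : ℕ → ℝ} {ρ σ C : ℝ} (h : GSBound M ρ σ C f) (k l : ℕ → ℕ) :
    LacunaryGSBound k l M ρ σ C f := by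
  constructor
  · intro j α hα x
    have := h α 0 x
    simpa [multiDeriv_zero, order_zero, hα] using this
  · intro j β hβ x
    have := h 0 β x
    simpa [monom, order_zero, hβ] using this

lemma gsBound_of_norm_pow_mul {M : ℕ → ℝ} (hM : IsWeightSequence M) {ρ σ C : ℝ}
    (h : ∀ (β : Fin n → ℕ) (x : EuclideanSpace ℝ (Fin n)) (i : ℕ),
      ‖WithLp.ofLp x‖ ^ i * ‖multiDeriv β f x‖ ≤
        C * ((ρ ^ i * M i) * (σ ^ order β * M (order β)))) : GSBound M ρ σ C f := by
  intro α β x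
  rw [hM.mul_root_pow, hM.mul_root_pow]
  exact (mul_le_mul_of_nonneg_right (abs_monom_le α x) (norm_nonneg _)).trans (h β x (order α))

variable {𝔐 : Set (ℕ → ℝ)} {k l : ℕ → ℕ}

/-- Total order supplies a single weight serving both base sequences: the larger of the two given by
the mixed conditions. -/
lemma exists_le_mem_of_mixed (h𝔐 : IsWeightFamily 𝔐) {M : ℕ → ℝ} (hM : M ∈ 𝔐)
    (hk : RoumieuMixed 𝔐 k) (hl : RoumieuMixed 𝔐 l) : ∃ N ∈ 𝔐, ∃ A > 0, ∃ B > 0,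
      (∀ j, root M (k (j + 1)) ≤ A * root N (k j)) ∧
      ∀ j, root M (l (j + 1)) ≤ B * root N (l j) := by
  obtain ⟨M₁, hM₁, A, hA⟩ := hk M hM
  obtain ⟨M₂, hM₂, B, hB⟩ := hl M hM
  obtain ⟨hA0, hA⟩ := pos_and_le_of_div_le (h𝔐.weight M hM) (h𝔐.weight M₁ hM₁) hA
  obtain ⟨hB0, hB⟩ := pos_and_le_of_div_le (h𝔐.weight M hM) (h𝔐.weight M₂ hM₂) hB
  have hroot : ∀ {P Q : ℕ → ℝ}, P ∈ 𝔐 → (∀ j, P j ≤ Q j) → ∀ j, root P j ≤ root Q j :=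
    fun hP h j => Real.rpow_le_rpow ((h𝔐.weight _ hP).pos j).le (h j) (by positivity)
  rcases h𝔐.total M₁ hM₁ M₂ hM₂ with h | h
  · exact ⟨M₂, hM₂, A, hA0, B, hB0, fun j => (hA j).trans
      (mul_le_mul_of_nonneg_left (hroot hM₁ h _) hA0.le), hB⟩
  · exact ⟨M₁, hM₁, A, hA0, B, hB0, hA, fun j => (hB j).trans
      (mul_le_mul_of_nonneg_left (hroot hM₂ h _) hB0.le)⟩

lemma sRoumieuLac_eq (hk : IsBaseSequence k) (hl : IsBaseSequence l) (h𝔐 : IsWeightFamily 𝔐)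
    (hRk : RoumieuMixed 𝔐 k) (hRl : RoumieuMixed 𝔐 l) (hMG : RoumieuModerateGrowth 𝔐)
    (hb : ∀ M ∈ 𝔐, ∃ A : ℝ, ∀ j : ℕ, (j : ℝ) / root M j ≤ A) :
    SRoumieuLac n 𝕜 𝔐 k l = SRoumieu n 𝕜 𝔐 := by
  ext f
  constructor
  · rintro ⟨hf, M, hM, ρ, hρ, σ, hσ, C, hC, h⟩
    refine ⟨hf, ?_⟩
    obtain ⟨N, hN, A, hA0, B, hB0, hA, hB⟩ := exists_le_mem_of_mixed h𝔐 hM hRk hRl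
    obtain ⟨N', hN', H, hH, hMG⟩ := hMG N hN
    obtain ⟨D, hD⟩ := hb N' hN'
    have hMw := h𝔐.weight M hM
    have hNw := h𝔐.weight N hN
    have hN'w := h𝔐.weight N' hN'
    have h2n : (1 : ℝ) ≤ 2 ^ n := one_le_pow₀ (by norm_num)
    -- The radii are enlarged so that `1 ≤ ρ' * root N i` and `(n + 1) s ≤ σ' * H * root N' s`,
    -- which allows `C₃ = C₄ = 1`.
    set ρ' := max 1 (A * ρ) with hρ'
    set σ' := max (12 * B * σ) ((n + 1) * D / H) with hσ'
    have hρ'1 : 1 ≤ ρ' := le_max_left _ _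
    have hσ'0 : 0 < σ' := lt_max_of_lt_left (by positivity)
    refine ⟨N', hN', 2 * ρ' * H, by positivity, 24 * σ' * H, by positivity,
      2 ^ n * (2 ^ n * C * (1 + 1)) * (1 + 1), by positivity, gsBound_of_norm_pow_mul hN'w ?_⟩
    refine norm_pow_mul_multiDeriv_le hf hNw hN'w hH hMG (by positivity) hσ'0 (by positivity)
      one_pos one_pos ?_ ?_ ?_ ?_
    · intro x i
      refine (h.pow_mul_norm_le hk hMw hNw hρ hC hA0 hA x i).trans ?_
      have := hNw.pos i
      gcongr
      · exact le_mul_of_one_le_left hC.le h2n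
      · exact le_max_right _ _
    · intro β x
      refine (h.norm_multiDeriv_le hf hl hMw hNw hσ hC hB0 hB β x).trans ?_
      have := hNw.pos (order β)
      gcongr
      exact le_max_left _ _
    · intro i
      rw [one_mul, ← hNw.mul_root_pow]
      exact one_le_pow₀ (one_le_mul_of_one_le_of_one_le hρ'1 (hNw.one_le_root i))
    · intro s
      rw [one_mul, ← hN'w.mul_root_pow]
      refine pow_le_pow_left₀ (by positivity) ?_ _
      have h1 := hD s
      have h2 := hN'w.root_pos s
      have h3 : (n + 1) * D / H ≤ σ' := le_max_right _ _
      rw [div_le_iff₀ h2] at h1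
      rw [div_le_iff₀ hH] at h3
      calc ((n : ℝ) + 1) * s ≤ (n + 1) * (D * root N' s) := by gcongr
        _ = (n + 1) * D * root N' s := by ring
        _ ≤ _ := by gcongr
  · rintro ⟨hf, M, hM, ρ, hρ, σ, hσ, C, hC, h⟩
    exact ⟨hf, M, hM, ρ, hρ, σ, hσ, C, hC, h.lacunary k l⟩

lemma sBeurlingLac_eq (hk : IsBaseSequence k) (hl : IsBaseSequence l) (h𝔐 : IsWeightFamily 𝔐)
    (hBk : BeurlingMixed 𝔐 k) (hBl : BeurlingMixed 𝔐 l) (hMG : BeurlingModerateGrowth 𝔐)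
    (hb : ∀ M ∈ 𝔐, Tendsto (fun j : ℕ => (j : ℝ) / root M j) atTop (𝓝 0)) :
    SBeurlingLac n 𝕜 𝔐 k l = SBeurling n 𝕜 𝔐 := by
  ext f
  constructor
  · rintro ⟨hf, h⟩
    refine ⟨hf, fun M hM ρ hρ σ hσ => ?_⟩
    obtain ⟨N, hN, H, hH, hMG⟩ := hMG M hM
    obtain ⟨N₁, hN₁, A, hA⟩ := hBk N hN
    obtain ⟨N₂, hN₂, B, hB⟩ := hBl N hN
    have hMw := h𝔐.weight M hM
    have hNw := h𝔐.weight N hN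
    have hN₁w := h𝔐.weight N₁ hN₁
    have hN₂w := h𝔐.weight N₂ hN₂
    obtain ⟨hA0, hA⟩ := pos_and_le_of_div_le hN₁w hNw hA
    obtain ⟨hB0, hB⟩ := pos_and_le_of_div_le hN₂w hNw hB
    have h2n : (1 : ℝ) ≤ 2 ^ n := one_le_pow₀ (by norm_num)
    set ρ' := ρ / (2 * H) with hρ'
    set σ' := σ / (24 * H) with hσ'
    have hρ'0 : 0 < ρ' := by positivity
    have hσ'0 : 0 < σ' := by positivity
    -- Decay and derivative bounds are taken from different weights; in each instance the other
    -- radius is irrelevant and set to `1`.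
    obtain ⟨C₁, hC₁, h₁⟩ := h N₁ hN₁ (ρ' / A) (by positivity) 1 one_pos
    obtain ⟨C₂, hC₂, h₂⟩ := h N₂ hN₂ 1 one_pos (σ' / (12 * B)) (by positivity)
    have hev : ∀ P ∈ 𝔐, ∀ ε > 0, ∀ᶠ j : ℕ in atTop, (j : ℝ) ≤ ε * root P j := by
      intro P hP ε hε
      filter_upwards [(hb P hP).eventually_le_const hε] with j hj
      rwa [div_le_iff₀ ((h𝔐.weight P hP).root_pos j)] at hj
    -- With prescribed radii the lower bounds on the weights hold only eventually, because `j / mⱼ`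
    -- tends to `0`; the constants `C₃` and `C₄` absorb the finitely many exceptions.
    obtain ⟨C₃, hC₃, h₃⟩ := exists_const_of_eventually_le (g := fun _ => 1)
      (h := fun i => ρ' ^ i * N i) (fun _ => zero_le_one)
      (fun i => mul_pos (by positivity) (hNw.pos i)) (by
        filter_upwards [hev N hN ρ' hρ'0, eventually_ge_atTop 1] with i hi hi1
        rw [← hNw.mul_root_pow]
        refine one_le_pow₀ (le_trans ?_ hi)
        exact_mod_cast hi1)
    obtain ⟨C₄, hC₄, h₄⟩ := exists_const_of_eventually_le (g := fun s => ((n + 1) * s : ℝ) ^ s)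
      (h := fun s => (σ' * H) ^ s * M s) (fun _ => by positivity)
      (fun s => mul_pos (by positivity) (hMw.pos s)) (by
        filter_upwards [hev M hM (σ' * H / (n + 1)) (by positivity)] with s hs
        rw [← hMw.mul_root_pow]
        refine pow_le_pow_left₀ (by positivity) ?_ _
        calc ((n : ℝ) + 1) * s ≤ (n + 1) * (σ' * H / (n + 1) * root M s) := by gcongr
          _ = _ := by field_simp)
    have hfin := norm_pow_mul_multiDeriv_le hf hNw hMw hH hMG hρ'0 hσ'0
      (C := 2 ^ n * (C₁ + C₂)) (by positivity) hC₃ hC₄ ?_ ?_ h₃ h₄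
    · have e1 : 2 * ρ' * H = ρ := by
        rw [hρ']
        field_simp
      have e2 : 24 * σ' * H = σ := by
        rw [hσ']
        field_simp
      rw [e1, e2] at hfin
      exact ⟨_, by positivity, gsBound_of_norm_pow_mul hMw hfin⟩
    · intro x i
      refine (h₁.pow_mul_norm_le hk hN₁w hNw (by positivity) hC₁ hA0 hA x i).trans ?_
      rw [mul_div_cancel₀ _ hA0.ne']
      have := hNw.pos i
      gcongr
      calc C₁ ≤ 1 * (C₁ + C₂) := by linarith
        _ ≤ _ := by gcongr
    · intro β x
      refine (h₂.norm_multiDeriv_le hf hl hN₂w hNw (by positivity) hC₂ hB0 hB β x).trans ?_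
      rw [mul_div_cancel₀ _ (by positivity)]
      have := hNw.pos (order β)
      gcongr
      linarith
  · rintro ⟨hf, h⟩
    refine ⟨hf, fun M hM ρ hρ σ hσ => ?_⟩
    obtain ⟨C, hC, hb⟩ := h M hM ρ hρ σ hσ
    exact ⟨C, hC, hb.lacunary k l⟩

end GelfandShilov

end Lacunary

theorem mainTheorem3 {𝕜 : Type*} [RCLike 𝕜] (n : ℕ) (p : ℝ≥0∞) (hp : 1 ≤ p)
    (k l : ℕ → ℕ) (hk : IsBaseSequence k) (hl : IsBaseSequence l)
    (𝔐 : Set (ℕ → ℝ)) (h𝔐 : IsWeightFamily 𝔐) :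
    -- Roumieu case
    (RoumieuMixed 𝔐 k →
      BRoumieu n 𝕜 𝔐 p (Set.range k) = BRoumieu n 𝕜 𝔐 p Set.univ ∧
      DRoumieu n 𝕜 𝔐 (Set.range k) = DRoumieu n 𝕜 𝔐 Set.univ ∧
      ((∀ M ∈ 𝔐, ∃ A : ℝ, ∀ j : ℕ, (j : ℝ) / root M j ≤ A) →
        (IsSpecialBaseSequence k → ∀ U : Set (EuclideanSpace ℝ (Fin n)), IsOpen U →
          ERoumieu 𝕜 𝔐 p U (Set.range k) = ERoumieu 𝕜 𝔐 p U Set.univ) ∧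
        (RoumieuMixed 𝔐 l → RoumieuModerateGrowth 𝔐 →
          SRoumieuLac n 𝕜 𝔐 k l = SRoumieu n 𝕜 𝔐))) ∧
    -- Beurling case
    (BeurlingMixed 𝔐 k →
      BBeurling n 𝕜 𝔐 p (Set.range k) = BBeurling n 𝕜 𝔐 p Set.univ ∧
      DBeurling n 𝕜 𝔐 (Set.range k) = DBeurling n 𝕜 𝔐 Set.univ ∧
      ((∀ M ∈ 𝔐, Tendsto (fun j : ℕ => (j : ℝ) / root M j) atTop (𝓝 0)) →
        (IsSpecialBaseSequence k → ∀ U : Set (EuclideanSpace ℝ (Fin n)), IsOpen U →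
          EBeurling 𝕜 𝔐 p U (Set.range k) = EBeurling 𝕜 𝔐 p U Set.univ) ∧
        (BeurlingMixed 𝔐 l → BeurlingModerateGrowth 𝔐 →
          SBeurlingLac n 𝕜 𝔐 k l = SBeurling n 𝕜 𝔐))) := by
  refine ⟨fun hR => ⟨bRoumieu_eq hp hk h𝔐 hR, ?_, fun hb => ⟨fun _ U hU => ?_, fun hRl hMG => ?_⟩⟩,
    fun hB => ⟨bBeurling_eq hp hk h𝔐 hB, ?_, fun hb => ⟨fun _ U hU => ?_, fun hBl hMG => ?_⟩⟩⟩
  · rw [DRoumieu, DRoumieu, bRoumieu_eq le_top hk h𝔐 hR]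
  · exact eRoumieu_eq hp hk h𝔐 hR hb hU
  · exact sRoumieuLac_eq hk hl h𝔐 hR hRl hMG hb
  · rw [DBeurling, DBeurling, bBeurling_eq le_top hk h𝔐 hB]
  · exact eBeurling_eq hp hk h𝔐 hB hb hU
  · exact sBeurlingLac_eq hk hl h𝔐 hB hBl hMG hb
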